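/- Let $S$ be a nonempty smooth surface in the affine space $A^3=\mathbb{R}^3$ that is regular elliptical: for each $p\in S$ there is an affine coordinate system $(x,y,z)$ with origin $p$ in which $S$ is, near $p$, the graph of a smooth function with expansion $$z=\tfrac12(x^2+y^2)+\tfrac16(x^3-3xy^2)+\sum_{i+j=4}\frac{I_{ij}}{i!\,j!}x^iy^j+\cdots .$$ The coefficients $I_{40},I_{31},I_{22},I_{13},I_{04}$ are the fundamental curvatures of $S$ at $p$; they are determined by $S$ and $p$ up to the action of the finite group $D_3$ of affine transformations preserving the third-order standard form. Suppose that $S$ has constant curvatures, that is, $(I_{40},I_{31},I_{22},I_{13},I_{04})\in\mathbb{R}^5$ is fixed and at every point $p\in S$ such a coordinate system can be chosen for which the fourth-order coefficients are these numbers. Then $(I_{40},I_{31},I_{22},I_{13},I_{04})$ has one of the following forms, with real parameters $k,l$ and, within each row, all upper or all lower signs: 1. $(k,\ 0,\ -1,\ 0,\ 3)$; 2. $(-3k^2+6k,\ 0,\ -k^2+2k+2,\ 0,\ -3k^2-6k)$; 3. $(k,\ l,\ k,\ 0,\ -3k)$; 4. $(k,\ \pm\sqrt{k(3-k)},\ -k+2,\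 \mp\sqrt{k(3-k)},\ k)$ with $0<k<3$; 5. $\bigl(-3k^2\pm\tfrac34k+\tfrac94,\ -\tfrac{3\sqrt3}{4}(3k\mp1),\ -k^2\pm\tfrac14k-\tfrac14,\ -\tfrac{3\sqrt3}{4}(k\pm1),\ -3k^2\mp\tfrac{21}{4}k+\tfrac94\bigr)$; 6. $\bigl(k,\ \pm\tfrac{\sqrt3}{2}(2k-3),\ 3k-1,\ \pm\tfrac{3\sqrt3}{2}(2k-1),\ 9k-6\bigr)$. -/

import Mathlib

open Filter Topology Matrix
open scoped ContDiff

namespace AffineSurface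

/-- The partial derivative with respect to the first variable. -/
noncomputable def pdx (f : ℝ × ℝ → ℝ) : ℝ × ℝ → ℝ := fun q => fderiv ℝ f q (1, 0)

/-- The partial derivative with respect to the second variable. -/
noncomputable def pdy (f : ℝ × ℝ → ℝ) : ℝ × ℝ → ℝ := fun q => fderiv ℝ f q (0, 1)

/-- The jet coordinate `a_ij` of the graph of `f` at the origin, that is
`∂^(i+j) f / ∂x^i ∂y^j (0, 0)`. -/
noncomputable def jetCoeff (f : ℝ × ℝ → ℝ) (i j : ℕ) : ℝ := (pdx^[i] (pdy^[j] f)) (0, 0)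

/-- In the affine coordinates `v` given by `w = B v + p`, with `B` invertible, the subset `S` of
affine 3-space is near `p` (that is, near `v = 0`) the graph `z = f (x, y)` of a function that is
smooth near the origin. -/
structure IsGraphAt (S : Set (Fin 3 → ℝ)) (p : Fin 3 → ℝ) (B : Matrix (Fin 3) (Fin 3) ℝ)
    (f : ℝ × ℝ → ℝ) : Prop where
  det_ne_zero : B.det ≠ 0
  smooth : ∀ᶠ q in 𝓝 ((0, 0) : ℝ × ℝ), ContDiffAt ℝ ∞ f q
  graph : ∀ᶠ v in 𝓝 (0 : Fin 3 → ℝ), (B *ᵥ v + p ∈ S ↔ v 2 = f (v 0, v 1))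

/-- The 3-jet of `f` at the origin is the standard form of the regular elliptical type,
`z = (x ^ 2 + y ^ 2) / 2 + (x ^ 3 - 3 * x * y ^ 2) / 6 + ...`. -/
structure HasStandardJet (f : ℝ × ℝ → ℝ) : Prop where
  a00 : jetCoeff f 0 0 = 0
  a10 : jetCoeff f 1 0 = 0
  a01 : jetCoeff f 0 1 = 0
  a20 : jetCoeff f 2 0 = 1
  a11 : jetCoeff f 1 1 = 0
  a02 : jetCoeff f 0 2 = 1
  a30 : jetCoeff f 3 0 = 1
  a21 : jetCoeff f 2 1 = 0
  a12 : jetCoeff f 1 2 = -1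
  a03 : jetCoeff f 0 3 = 0

/-- `S` is a regular elliptical surface: around each of its points it is a smooth surface whose
jet there is carried by an affine transformation to the standard form of the regular elliptical
type. -/
def IsRegularElliptical (S : Set (Fin 3 → ℝ)) : Prop :=
  ∀ p ∈ S, ∃ (B : Matrix (Fin 3) (Fin 3) ℝ) (f : ℝ × ℝ → ℝ), IsGraphAt S p B f ∧ HasStandardJet f

/-- `(I40, I31, I22, I13, I04)` are values of the fundamental curvatures of `S` at `p`: they are
the fourth order jet coordinates at `p` in affine coordinates that bring the 3-jet of `S` at `p`
to the standard form. (Those coordinates are unique up to the dihedral symmetry group of the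
standard 3-jet, which has six elements.) -/
def HasCurvaturesAt (S : Set (Fin 3 → ℝ)) (p : Fin 3 → ℝ) (I40 I31 I22 I13 I04 : ℝ) : Prop :=
  ∃ (B : Matrix (Fin 3) (Fin 3) ℝ) (f : ℝ × ℝ → ℝ), IsGraphAt S p B f ∧ HasStandardJet f ∧
    jetCoeff f 4 0 = I40 ∧ jetCoeff f 3 1 = I31 ∧ jetCoeff f 2 2 = I22 ∧ jetCoeff f 1 3 = I13 ∧
    jetCoeff f 0 4 = I04

/-- `S` has the constant fundamental curvatures `(I40, I31, I22, I13, I04)`: at every point it can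
be normalized so that the curvatures have these values. -/
def HasConstantCurvatures (S : Set (Fin 3 → ℝ)) (I40 I31 I22 I13 I04 : ℝ) : Prop :=
  ∀ p ∈ S, HasCurvaturesAt S p I40 I31 I22 I13 I04

end AffineSurface

namespace AffineSurface

/-! Write the surface near one of its points as the graph of `f` in normal form. As the curvatures
are constant, an affine change carries the 4-jet of `f` at each nearby point to its 4-jet at the
origin (`eventually_exists_isNormalization`). Move the point along a coordinate axis and linearize
at the identity: orders two and three determine the velocity of the affine change, and order four
then determines fifth derivatives. The four mixed ones are obtained twice, along x and along y, and
equating the two values gives four quadrics in the curvatures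
(`IsInfinitesimalNormalization.compatibility`).

The affine changes are only known to exist point by point, with no continuity. They are bounded,
because their tangential columns are unit vectors for the Hessian, so a subsequence converges to a
symmetry of the standard jet; composing with its inverse makes the limit the identity
(`exists_normalizations_tendsto`). The secants from the limit then accumulate at a direction that
satisfies the linearized equations (`exists_tangent_direction`). This direction really moves the
base point, since the standard jet has no infinitesimal symmetries
(`IsInfinitesimalNormalization.eq_zero`).

The quadrics are solved in `curvatures_classification` by splitting the quartic form into its parts
of rotation weight 0, 2 and 4. -/

/-- A family `F i j` of functions that behaves on `U` like the family of the partial derivatives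
`∂^(i+j) f / ∂x^i ∂y^j` of a smooth function `f`. -/
structure IsJetFamily (F : ℕ → ℕ → ℝ × ℝ → ℝ) (U : Set (ℝ × ℝ)) : Prop where
  differentiableAt : ∀ i j, ∀ q ∈ U, DifferentiableAt ℝ (F i j) q
  pdx_eq : ∀ i j, ∀ q ∈ U, pdx (F i j) q = F (i + 1) j q
  pdy_eq : ∀ i j, ∀ q ∈ U, pdy (F i j) q = F i (j + 1) q

/-- The iterated partial derivatives of `f`. -/
noncomputable def partials (f : ℝ × ℝ → ℝ) (i j : ℕ) : ℝ × ℝ → ℝ := pdx^[i] (pdy^[j] f)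

/-! ### Partial derivatives of a smooth function -/

section Smooth

variable {U : Set (ℝ × ℝ)} {f g : ℝ × ℝ → ℝ}

lemma contDiffAt_fderiv_apply (v : ℝ × ℝ) (hf : ∀ q ∈ U, ContDiffAt ℝ ∞ f q) :
    ∀ q ∈ U, ContDiffAt ℝ ∞ (fun q => fderiv ℝ f q v) q := fun q hq =>
  ((hf q hq).fderiv_right (m := ∞) (by simp)).clm_apply contDiffAt_const

lemma contDiffAt_pdx_iterate (hf : ∀ q ∈ U, ContDiffAt ℝ ∞ f q) (i : ℕ) :
    ∀ q ∈ U, ContDiffAt ℝ ∞ (pdx^[i] f) q := by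
  induction i with
  | zero => exact hf
  | succ i ih =>
    rw [Function.iterate_succ_apply']
    exact contDiffAt_fderiv_apply _ ih

lemma contDiffAt_pdy_iterate (hf : ∀ q ∈ U, ContDiffAt ℝ ∞ f q) (i : ℕ) :
    ∀ q ∈ U, ContDiffAt ℝ ∞ (pdy^[i] f) q := by
  induction i with
  | zero => exact hf
  | succ i ih =>
    rw [Function.iterate_succ_apply']
    exact contDiffAt_fderiv_apply _ ih

lemma fderiv_fderiv_apply {q : ℝ × ℝ} (hf : ContDiffAt ℝ ∞ f q) (v w : ℝ × ℝ) :
    fderiv ℝ (fun q => fderiv ℝ f q v) q w = fderiv ℝ (fderiv ℝ f) q w v := by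
  have h : DifferentiableAt ℝ (fderiv ℝ f) q :=
    (hf.fderiv_right (m := ∞) (by simp)).differentiableAt (by simp)
  rw [fderiv_clm_apply h (differentiableAt_const v)]
  simp

lemma pdy_pdx_comm {q : ℝ × ℝ} (hf : ContDiffAt ℝ ∞ f q) : pdy (pdx f) q = pdx (pdy f) q := by
  unfold pdx pdy
  rw [fderiv_fderiv_apply hf, fderiv_fderiv_apply hf]
  exact (hf.isSymmSndFDerivAt (by simpa using WithTop.coe_le_coe.2 (le_top : (2 : ℕ∞) ≤ ⊤))).eq _ _

lemma pdx_congr (hU : IsOpen U) (h : Set.EqOn f g U) : Set.EqOn (pdx f) (pdx g) U := fun q hq => by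
  unfold pdx
  rw [(h.eventuallyEq_of_mem (hU.mem_nhds hq)).fderiv_eq]

/-- Symmetry of second derivatives, applied once per factor. The equality is kept on an open set
because it has to be differentiated again in the induction. -/
lemma pdy_pdx_iterate (hU : IsOpen U) (hf : ∀ q ∈ U, ContDiffAt ℝ ∞ f q) (i : ℕ) :
    Set.EqOn (pdy (pdx^[i] f)) (pdx^[i] (pdy f)) U := by
  induction i with
  | zero => exact fun _ _ => rfl
  | succ i ih =>
    intro q hq
    rw [Function.iterate_succ_apply', Function.iterate_succ_apply',
      pdy_pdx_comm (contDiffAt_pdx_iterate hf i q hq)]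
    exact pdx_congr hU ih hq

lemma isJetFamily_partials (hU : IsOpen U) (hf : ∀ q ∈ U, ContDiffAt ℝ ∞ f q) :
    IsJetFamily (partials f) U where
  differentiableAt i j q hq :=
    (contDiffAt_pdx_iterate (contDiffAt_pdy_iterate hf j) i q hq).differentiableAt (by simp)
  pdx_eq i j q _ := by rw [partials, partials, Function.iterate_succ_apply']
  pdy_eq i j q hq := by
    rw [partials, partials, Function.iterate_succ_apply']
    exact pdy_pdx_iterate hU (contDiffAt_pdy_iterate hf j) i hq

lemma exists_isJetFamily_partials (h : ∀ᶠ q in 𝓝 ((0, 0) : ℝ × ℝ), ContDiffAt ℝ ∞ f q) :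
    ∃ U : Set (ℝ × ℝ), IsOpen U ∧ (0, 0) ∈ U ∧ IsJetFamily (partials f) U := by
  obtain ⟨U, hU, hUo, h0⟩ := eventually_nhds_iff.1 h
  exact ⟨U, hUo, h0, isJetFamily_partials hUo hU⟩

end Smooth

lemma IsJetFamily.hasDerivAt_comp {F : ℕ → ℕ → ℝ × ℝ → ℝ} {U : Set (ℝ × ℝ)} (hF : IsJetFamily F U)
    (i j : ℕ) {x y : ℝ → ℝ} {x' y' s : ℝ} (hx : HasDerivAt x x' s) (hy : HasDerivAt y y' s)
    (hs : (x s, y s) ∈ U) :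
    HasDerivAt (fun s => F i j (x s, y s))
      (F (i + 1) j (x s, y s) * x' + F i (j + 1) (x s, y s) * y') s := by
  have h := (hF.differentiableAt i j _ hs).hasFDerivAt.comp_hasDerivAt s (hx.prodMk hy)
  refine h.congr_deriv ?_
  rw [← hF.pdx_eq i j _ hs, ← hF.pdy_eq i j _ hs, pdx, pdy]
  have : ((x', y') : ℝ × ℝ) = x' • (1, 0) + y' • (0, 1) := by simp
  rw [this, map_add, map_smul, map_smul, smul_eq_mul, smul_eq_mul]
  ring

/-! ### The chain rule along a curve, to order four -/

/-- The derivatives up to order four of `s ↦ F 0 0 (x 0 s, y 0 s)`, where `x (k + 1)`, `y (k + 1)`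
are the derivatives of `x k`, `y k`. -/
def compDeriv (F : ℕ → ℕ → ℝ × ℝ → ℝ) (x y : ℕ → ℝ → ℝ) (k : ℕ) (s : ℝ) : ℝ :=
  match k with
  | 0 => F 0 0 (x 0 s, y 0 s)
  | 1 => F 1 0 (x 0 s, y 0 s) * x 1 s + F 0 1 (x 0 s, y 0 s) * y 1 s
  | 2 => F 2 0 (x 0 s, y 0 s) * x 1 s ^ 2 + 2 * F 1 1 (x 0 s, y 0 s) * x 1 s * y 1 s
      + F 0 2 (x 0 s, y 0 s) * y 1 s ^ 2
      + F 1 0 (x 0 s, y 0 s) * x 2 s + F 0 1 (x 0 s, y 0 s) * y 2 s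
  | 3 => F 3 0 (x 0 s, y 0 s) * x 1 s ^ 3 + 3 * F 2 1 (x 0 s, y 0 s) * x 1 s ^ 2 * y 1 s
      + 3 * F 1 2 (x 0 s, y 0 s) * x 1 s * y 1 s ^ 2 + F 0 3 (x 0 s, y 0 s) * y 1 s ^ 3
      + 3 * (F 2 0 (x 0 s, y 0 s) * x 1 s * x 2 s
        + F 1 1 (x 0 s, y 0 s) * (x 1 s * y 2 s + x 2 s * y 1 s)
        + F 0 2 (x 0 s, y 0 s) * y 1 s * y 2 s)
      + F 1 0 (x 0 s, y 0 s) * x 3 s + F 0 1 (x 0 s, y 0 s) * y 3 s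
  | 4 => F 4 0 (x 0 s, y 0 s) * x 1 s ^ 4 + 4 * F 3 1 (x 0 s, y 0 s) * x 1 s ^ 3 * y 1 s
      + 6 * F 2 2 (x 0 s, y 0 s) * x 1 s ^ 2 * y 1 s ^ 2
      + 4 * F 1 3 (x 0 s, y 0 s) * x 1 s * y 1 s ^ 3 + F 0 4 (x 0 s, y 0 s) * y 1 s ^ 4
      + 6 * (F 3 0 (x 0 s, y 0 s) * x 1 s ^ 2 * x 2 s
        + F 2 1 (x 0 s, y 0 s) * (x 1 s ^ 2 * y 2 s + 2 * x 1 s * y 1 s * x 2 s)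
        + F 1 2 (x 0 s, y 0 s) * (y 1 s ^ 2 * x 2 s + 2 * x 1 s * y 1 s * y 2 s)
        + F 0 3 (x 0 s, y 0 s) * y 1 s ^ 2 * y 2 s)
      + 3 * (F 2 0 (x 0 s, y 0 s) * x 2 s ^ 2 + 2 * F 1 1 (x 0 s, y 0 s) * x 2 s * y 2 s
        + F 0 2 (x 0 s, y 0 s) * y 2 s ^ 2)
      + 4 * (F 2 0 (x 0 s, y 0 s) * x 1 s * x 3 s
        + F 1 1 (x 0 s, y 0 s) * (x 1 s * y 3 s + x 3 s * y 1 s)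
        + F 0 2 (x 0 s, y 0 s) * y 1 s * y 3 s)
      + F 1 0 (x 0 s, y 0 s) * x 4 s + F 0 1 (x 0 s, y 0 s) * y 4 s
  -- Never reached: `IsDerivChain` only relates orders 0 to 4.
  | _ => 0

/-- `x (k + 1)` is the derivative of `x k` near `0`, for `k < 4`. -/
def IsDerivChain (x : ℕ → ℝ → ℝ) : Prop :=
  ∀ k < 4, ∀ᶠ s in 𝓝 (0 : ℝ), HasDerivAt (x k) (x (k + 1) s) s

lemma IsDerivChain.continuousAt {x : ℕ → ℝ → ℝ} (hx : IsDerivChain x) :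
    ContinuousAt (x 0) 0 := (hx 0 (by norm_num)).self_of_nhds.continuousAt

/-- Derivatives are unique. Equality of germs, not just of values at 0, is what passes from one
order to the next. -/
lemma IsDerivChain.eventuallyEq {x y : ℕ → ℝ → ℝ} (hx : IsDerivChain x) (hy : IsDerivChain y)
    (h : x 0 =ᶠ[𝓝 0] y 0) : ∀ k ≤ 4, x k =ᶠ[𝓝 0] y k := by
  intro k
  induction k with
  | zero => exact fun _ => h
  | succ k ih =>
    intro hk
    filter_upwards [hx k hk, hy k hk, (ih (by omega)).eventuallyEq_nhds] with s h1 h2 h3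
    exact h1.unique (h2.congr_of_eventuallyEq h3)

lemma isDerivChain_compDeriv {F : ℕ → ℕ → ℝ × ℝ → ℝ} {U : Set (ℝ × ℝ)} (hU : IsOpen U)
    (hF : IsJetFamily F U) {x y : ℕ → ℝ → ℝ} (hx : IsDerivChain x) (hy : IsDerivChain y)
    (h0 : (x 0 0, y 0 0) ∈ U) : IsDerivChain (compDeriv F x y) := by
  have hmem : ∀ᶠ s in 𝓝 (0 : ℝ), (x 0 s, y 0 s) ∈ U :=
    (hx.continuousAt.prodMk hy.continuousAt).eventually_mem (hU.mem_nhds h0)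
  intro k hk
  filter_upwards [hmem, hx 0 (by norm_num), hx 1 (by norm_num), hx 2 (by norm_num),
    hx 3 (by norm_num), hy 0 (by norm_num), hy 1 (by norm_num), hy 2 (by norm_num),
    hy 3 (by norm_num)] with s hs x0 x1 x2 x3 y0 y1 y2 y3
  have c : ∀ i j, HasDerivAt (fun s => F i j (x 0 s, y 0 s))
      (F (i + 1) j (x 0 s, y 0 s) * x 1 s + F i (j + 1) (x 0 s, y 0 s) * y 1 s) s :=
    fun i j => hF.hasDerivAt_comp i j x0 y0 hs
  interval_cases k
  · exact c 0 0
  · refine (((c 1 0).mul x1).add ((c 0 1).mul y1)).congr_deriv ?_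
    simp only [compDeriv]; ring
  · refine ((((((c 2 0).mul (x1.pow 2)).add ((((c 1 1).const_mul 2).mul x1).mul y1)).add
      ((c 0 2).mul (y1.pow 2))).add ((c 1 0).mul x2)).add ((c 0 1).mul y2)).congr_deriv ?_
    simp only [compDeriv]; simp; ring
  · refine (((((((((c 3 0).mul (x1.pow 3)).add ((((c 2 1).const_mul 3).mul (x1.pow 2)).mul y1)).add
      ((((c 1 2).const_mul 3).mul x1).mul (y1.pow 2))).add ((c 0 3).mul (y1.pow 3))).add
      ((((((c 2 0).mul x1).mul x2).add ((c 1 1).mul ((x1.mul y2).add (x2.mul y1)))).add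
        (((c 0 2).mul y1).mul y2)).const_mul 3)).add ((c 1 0).mul x3)).add
        ((c 0 1).mul y3))).congr_deriv ?_
    simp only [compDeriv]; simp; ring

/-! ### Forms of a jet, normalizations and the compatibility quadrics -/

/-- The quadratic form of the second derivatives of a jet. -/
def form2 (J : ℕ → ℕ → ℝ) (x y : ℝ) : ℝ := J 2 0 * x ^ 2 + 2 * J 1 1 * x * y + J 0 2 * y ^ 2

/-- The cubic form of the third derivatives of a jet. -/
def form3 (J : ℕ → ℕ → ℝ) (x y : ℝ) : ℝ :=
  J 3 0 * x ^ 3 + 3 * J 2 1 * x ^ 2 * y + 3 * J 1 2 * x * y ^ 2 + J 0 3 * y ^ 3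

/-- The quartic form of the fourth derivatives of a jet. -/
def form4 (J : ℕ → ℕ → ℝ) (x y : ℝ) : ℝ :=
  J 4 0 * x ^ 4 + 4 * J 3 1 * x ^ 3 * y + 6 * J 2 2 * x ^ 2 * y ^ 2 + 4 * J 1 3 * x * y ^ 3
    + J 0 4 * y ^ 4

/-- The symmetric bilinear form of `form2 J`. -/
def polar2 (J : ℕ → ℕ → ℝ) (x y u v : ℝ) : ℝ :=
  J 2 0 * x * u + J 1 1 * (x * v + y * u) + J 0 2 * y * v

/-- The symmetric trilinear form of `form3 J` at `(x, y), (x, y), (u, v)`. -/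
def polar3 (J : ℕ → ℕ → ℝ) (x y u v : ℝ) : ℝ :=
  (J 3 0 * x ^ 2 + 2 * J 2 1 * x * y + J 1 2 * y ^ 2) * u
    + (J 2 1 * x ^ 2 + 2 * J 1 2 * x * y + J 0 3 * y ^ 2) * v

/-- The symmetric quadrilinear form of `form4 J` at `(x, y), (x, y), (x, y), (u, v)`. -/
def polar4 (J : ℕ → ℕ → ℝ) (x y u v : ℝ) : ℝ :=
  (J 4 0 * x ^ 3 + 3 * J 3 1 * x ^ 2 * y + 3 * J 2 2 * x * y ^ 2 + J 1 3 * y ^ 3) * u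
    + (J 3 1 * x ^ 3 + 3 * J 2 2 * x ^ 2 * y + 3 * J 1 3 * x * y ^ 2 + J 0 4 * y ^ 3) * v

/-- The standard values of the derivatives of orders two and three. -/
structure IsStandard (K : ℕ → ℕ → ℝ) : Prop where
  a20 : K 2 0 = 1
  a11 : K 1 1 = 0
  a02 : K 0 2 = 1
  a30 : K 3 0 = 1
  a21 : K 2 1 = 0
  a12 : K 1 2 = -1
  a03 : K 0 3 = 0

/-- The affine change of coordinates with linear part `θ 0, ..., θ 3` on the tangent plane,
transversal direction `θ 4, θ 5` and scale `θ 6` carries the derivatives `J` of orders two to four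
to the derivatives `K`. -/
structure IsNormalization (J K : ℕ → ℕ → ℝ) (θ : Fin 7 → ℝ) : Prop where
  two : ∀ x y, form2 J (θ 0 * x + θ 1 * y) (θ 2 * x + θ 3 * y) - form2 K x y = 0
  three : ∀ x y, form3 J (θ 0 * x + θ 1 * y) (θ 2 * x + θ 3 * y)
    + 3 * polar2 J (θ 0 * x + θ 1 * y) (θ 2 * x + θ 3 * y) (θ 4) (θ 5) * form2 K x y
    - θ 6 * form3 K x y = 0
  four : ∀ x y, form4 J (θ 0 * x + θ 1 * y) (θ 2 * x + θ 3 * y)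
    + 6 * polar3 J (θ 0 * x + θ 1 * y) (θ 2 * x + θ 3 * y) (θ 4) (θ 5) * form2 K x y
    + 3 * form2 J (θ 4) (θ 5) * form2 K x y ^ 2
    + 4 * θ 6 * polar2 J (θ 0 * x + θ 1 * y) (θ 2 * x + θ 3 * y) (θ 4) (θ 5) * form3 K x y
    - θ 6 ^ 2 * form4 K x y = 0

/-- The linearization of `IsNormalization J K θ` at `J = K` and the identity, where `J` moves with
velocity `τ • J'` and `θ` is the velocity of the change of coordinates. -/
structure IsInfinitesimalNormalization (K J' : ℕ → ℕ → ℝ) (τ : ℝ) (θ : Fin 7 → ℝ) : Prop where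
  two : ∀ x y, τ * form2 J' x y + 2 * polar2 K x y (θ 0 * x + θ 1 * y) (θ 2 * x + θ 3 * y) = 0
  three : ∀ x y, τ * form3 J' x y + 3 * polar3 K x y (θ 0 * x + θ 1 * y) (θ 2 * x + θ 3 * y)
    + 3 * polar2 K x y (θ 4) (θ 5) * form2 K x y - θ 6 * form3 K x y = 0
  four : ∀ x y, τ * form4 J' x y + 4 * polar4 K x y (θ 0 * x + θ 1 * y) (θ 2 * x + θ 3 * y)
    + 6 * polar3 K x y (θ 4) (θ 5) * form2 K x y + 4 * polar2 K x y (θ 4) (θ 5) * form3 K x y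
    - 2 * θ 6 * form4 K x y = 0

namespace IsInfinitesimalNormalization

variable {K J' : ℕ → ℕ → ℝ} {θ : Fin 7 → ℝ} {τ : ℝ}

/-- Orders two and three give 3 + 4 linear equations for the seven unknowns, and their only solution
is zero: the symmetry group of the standard 3-jet is discrete. -/
lemma eq_zero (hK : IsStandard K) (h : IsInfinitesimalNormalization K J' 0 θ) : θ = 0 := by
  have h2 := h.two
  have h3 := h.three
  simp only [polar2, polar3, form2, form3, hK.a20, hK.a11, hK.a02, hK.a30, hK.a21, hK.a12,
    hK.a03] at h2 h3
  have a1 := h2 1 0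
  have a2 := h2 0 1
  have a3 := h2 1 1
  have b1 := h3 1 0
  have b2 := h3 0 1
  have b3 := h3 1 1
  have b4 := h3 1 (-1)
  ring_nf at a1 a2 a3 b1 b2 b3 b4
  funext i
  fin_cases i <;> simp only [Pi.zero_apply, Fin.reduceFinMk, Fin.zero_eta, Fin.mk_one] <;> linarith

lemma smul (h : IsInfinitesimalNormalization K J' τ θ) (c : ℝ) :
    IsInfinitesimalNormalization K J' (c * τ) (c • θ) where
  two x y := by
    have := h.two x y
    simp only [polar2, Pi.smul_apply, smul_eq_mul] at this ⊢
    linear_combination c * this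
  three x y := by
    have := h.three x y
    simp only [polar2, polar3, Pi.smul_apply, smul_eq_mul] at this ⊢
    linear_combination c * this
  four x y := by
    have := h.four x y
    simp only [polar2, polar3, polar4, Pi.smul_apply, smul_eq_mul] at this ⊢
    linear_combination c * this

/-- Infinitesimal normalizations along both coordinate axes force four quadratic relations between
the derivatives of order four. -/
lemma compatibility {η : Fin 7 → ℝ} (hK : IsStandard K)
    (h : IsInfinitesimalNormalization K (fun i j => K (i + 1) j) 1 θ)
    (h' : IsInfinitesimalNormalization K (fun i j => K i (j + 1)) 1 η) {p q r s t : ℝ}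
    (hp : K 4 0 = p) (hq : K 3 1 = q) (hr : K 2 2 = r) (hs : K 1 3 = s) (ht : K 0 4 = t) :
    3 * p * q + 17 * p * s - 15 * q * r - 4 * q * t + 3 * r * s - 36 * s = 0 ∧
    3 * p * r + p * t + 10 * q * s - 9 * r ^ 2 - 3 * r * t + 18 * r + 2 * s ^ 2 + 6 * t = 0 ∧
    6 * p * s - 3 * q * r - q * t + 3 * r * s - s * t - 12 * s = 0 ∧
    6 * p * t - 18 * p + 6 * q * s - 9 * r ^ 2 - 12 * r * t + 18 * r + 14 * s ^ 2 - t ^ 2 = 0 := by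
  obtain ⟨h2, h3, h4⟩ := h
  obtain ⟨g2, g3, g4⟩ := h'
  simp only [polar2, polar3, polar4, form2, form3, form4, hK.a20, hK.a11, hK.a02, hK.a30, hK.a21,
    hK.a12, hK.a03, hp, hq, hr, hs, ht, Nat.reduceAdd, zero_add] at h2 h3 h4 g2 g3 g4
  -- A binary form of degree n is determined by its values at n + 1 pairwise independent vectors:
  -- three values here, four for the cubic, five for the quartic.
  have a1 := h2 1 0
  have a2 := h2 0 1
  have a3 := h2 1 1
  have b1 := h3 1 0
  have b2 := h3 0 1
  have b3 := h3 1 1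
  have b4 := h3 1 (-1)
  ring_nf at a1 a2 a3 b1 b2 b3 b4
  -- The derivative along x of the 3-jet consists of third and fourth derivatives, all known, so
  -- orders two and three can be solved for `θ`.
  have t6 : θ 6 = (p - 3 * r) / 4 := by linarith
  have t1 : θ 1 = -(3 * q - s) / 12 := by linarith
  have t2 : θ 2 = (3 * q - s) / 12 := by linarith
  have t0 : θ 0 = -1 / 2 := by linarith
  have t3 : θ 3 = 1 / 2 := by linarith
  have t4 : θ 4 = 1 / 2 - (p + r) / 4 := by linarith
  have t5 : θ 5 = -(q + s) / 4 := by linarith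
  clear a1 a2 a3 b1 b2 b3 b4
  have a1 := g2 1 0
  have a2 := g2 0 1
  have a3 := g2 1 1
  have b1 := g3 1 0
  have b2 := g3 0 1
  have b3 := g3 1 1
  have b4 := g3 1 (-1)
  ring_nf at a1 a2 a3 b1 b2 b3 b4
  have s6 : η 6 = (q - 3 * s) / 4 := by linarith
  have s1 : η 1 = 1 / 2 - (3 * r - t) / 12 := by linarith
  have s2 : η 2 = 1 / 2 + (3 * r - t) / 12 := by linarith
  have s0 : η 0 = 0 := by linarith
  have s3 : η 3 = 0 := by linarith
  have s4 : η 4 = -(q + s) / 4 := by linarith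
  have s5 : η 5 = 1 / 2 - (r + t) / 4 := by linarith
  clear a1 a2 a3 b1 b2 b3 b4 h2 h3 g2 g3
  rw [t0, t1, t2, t3, t4, t5, t6] at h4
  rw [s0, s1, s2, s3, s4, s5, s6] at g4
  have c1 := h4 1 0
  have c2 := h4 0 1
  have c3 := h4 1 1
  have c4 := h4 1 (-1)
  have c5 := h4 2 1
  have d1 := g4 1 0
  have d2 := g4 0 1
  have d3 := g4 1 1
  have d4 := g4 1 (-1)
  have d5 := g4 2 1
  clear h4 g4
  ring_nf at c1 c2 c3 c4 c5 d1 d2 d3 d4 d5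
  -- The ten equations are linear in the six fifth derivatives. `K 4 1`, `K 3 2`, `K 2 3` and `K 1
  -- 4` occur in both directions; eliminating them leaves four relations.
  refine ⟨?_, ?_, ?_, ?_⟩ <;> linarith

end IsInfinitesimalNormalization

/-! ### Linearization along a sequence of normalizations -/

/-- A sequence of zeros of a family of functions that converges to `x₀` has a limit direction, and
the derivatives of all the functions at `x₀` vanish in that direction. -/
lemma exists_tangent_direction {E : Type*} [NormedAddCommGroup E] [NormedSpace ℝ E]
    [ProperSpace E] {x : ℕ → E} {x₀ : E} (hx : Tendsto x atTop (𝓝 x₀)) (hne : ∀ n, x n ≠ x₀) :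
    ∃ d : E, d ≠ 0 ∧ ∀ F : E → ℝ, DifferentiableAt ℝ F x₀ → (∀ n, F (x n) = 0) →
      ∀ c, HasDerivAt (fun s : ℝ => F (x₀ + s • d)) c 0 → c = 0 := by
  have hpos : ∀ n, 0 < ‖x n - x₀‖ := fun n => norm_pos_iff.2 (sub_ne_zero.2 (hne n))
  obtain ⟨d, hd, φ, hφ, hlim⟩ := (isCompact_sphere (0 : E) 1).tendsto_subseq
    (x := fun n => ‖x n - x₀‖⁻¹ • (x n - x₀)) (fun n => by
      simp [norm_smul, (hpos n).ne'])
  refine ⟨d, fun h => by simp [h] at hd, fun F hF h0 c hc => ?_⟩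
  have hx' : Tendsto (x ∘ φ) atTop (𝓝 x₀) := hx.comp hφ.tendsto_atTop
  have hF0 : F x₀ = 0 :=
    tendsto_nhds_unique (hF.continuousAt.tendsto.comp hx) (by simp [Function.comp_def, h0])
  -- As `F` vanishes at `x₀` and at every `x n`, its derivative on the secant `x n - x₀` is o(‖x n -
  -- x₀‖); divide by the norm and pass to the limit.
  have key : fderiv ℝ F x₀ d = 0 := by
    have h1 : Tendsto (fun n => ‖x (φ n) - x₀‖⁻¹ * fderiv ℝ F x₀ (x (φ n) - x₀)) atTop
        (𝓝 (fderiv ℝ F x₀ d)) := by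
      have := ((fderiv ℝ F x₀).continuous.tendsto d).comp hlim
      simpa [Function.comp_def] using this
    have h2 : Tendsto (fun n => ‖x (φ n) - x₀‖⁻¹ * ‖fderiv ℝ F x₀ (x (φ n) - x₀)‖) atTop
        (𝓝 0) := by
      have := (hasFDerivAt_iff_tendsto.1 hF.hasFDerivAt).comp hx'
      simpa [Function.comp_def, h0, hF0, abs_sub_comm] using this
    refine tendsto_nhds_unique h1 (tendsto_zero_iff_norm_tendsto_zero.2 ?_)
    simpa [norm_mul] using h2
  have hl : HasDerivAt (fun s : ℝ => x₀ + s • d) d 0 := by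
    simpa using ((hasDerivAt_id (0 : ℝ)).smul_const d).const_add x₀
  have := HasFDerivAt.comp_hasDerivAt (f := fun s : ℝ => x₀ + s • d) 0
    (by simpa using hF.hasFDerivAt) hl
  rw [hc.unique this, key]

section Derivatives

variable {E : Type*} [NormedAddCommGroup E] [NormedSpace ℝ E] {J : E → ℕ → ℕ → ℝ}
  {X Y U V : E → ℝ} {x₀ : E}

lemma differentiableAt_form2 (hJ : ∀ i j, DifferentiableAt ℝ (fun x => J x i j) x₀)
    (hX : DifferentiableAt ℝ X x₀) (hY : DifferentiableAt ℝ Y x₀) :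
    DifferentiableAt ℝ (fun x => form2 (J x) (X x) (Y x)) x₀ := by
  unfold form2
  have h1 := hJ 2 0
  have h2 := hJ 1 1
  have h3 := hJ 0 2
  fun_prop

lemma differentiableAt_form3 (hJ : ∀ i j, DifferentiableAt ℝ (fun x => J x i j) x₀)
    (hX : DifferentiableAt ℝ X x₀) (hY : DifferentiableAt ℝ Y x₀) :
    DifferentiableAt ℝ (fun x => form3 (J x) (X x) (Y x)) x₀ := by
  unfold form3
  have h1 := hJ 3 0
  have h2 := hJ 2 1
  have h3 := hJ 1 2
  have h4 := hJ 0 3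
  fun_prop

lemma differentiableAt_form4 (hJ : ∀ i j, DifferentiableAt ℝ (fun x => J x i j) x₀)
    (hX : DifferentiableAt ℝ X x₀) (hY : DifferentiableAt ℝ Y x₀) :
    DifferentiableAt ℝ (fun x => form4 (J x) (X x) (Y x)) x₀ := by
  unfold form4
  have h1 := hJ 4 0
  have h2 := hJ 3 1
  have h3 := hJ 2 2
  have h4 := hJ 1 3
  have h5 := hJ 0 4
  fun_prop

lemma differentiableAt_polar2 (hJ : ∀ i j, DifferentiableAt ℝ (fun x => J x i j) x₀)
    (hX : DifferentiableAt ℝ X x₀) (hY : DifferentiableAt ℝ Y x₀)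
    (hU : DifferentiableAt ℝ U x₀) (hV : DifferentiableAt ℝ V x₀) :
    DifferentiableAt ℝ (fun x => polar2 (J x) (X x) (Y x) (U x) (V x)) x₀ := by
  unfold polar2
  have h1 := hJ 2 0
  have h2 := hJ 1 1
  have h3 := hJ 0 2
  fun_prop

lemma differentiableAt_polar3 (hJ : ∀ i j, DifferentiableAt ℝ (fun x => J x i j) x₀)
    (hX : DifferentiableAt ℝ X x₀) (hY : DifferentiableAt ℝ Y x₀)
    (hU : DifferentiableAt ℝ U x₀) (hV : DifferentiableAt ℝ V x₀) :
    DifferentiableAt ℝ (fun x => polar3 (J x) (X x) (Y x) (U x) (V x)) x₀ := by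
  unfold polar3
  have h1 := hJ 3 0
  have h2 := hJ 2 1
  have h3 := hJ 1 2
  have h4 := hJ 0 3
  fun_prop

end Derivatives

section Derivatives

variable {J : ℝ → ℕ → ℕ → ℝ} {J' : ℕ → ℕ → ℝ} {X Y U V : ℝ → ℝ} {X' Y' U' V' s : ℝ}

lemma hasDerivAt_form2 (hJ : ∀ i j, HasDerivAt (fun t => J t i j) (J' i j) s)
    (hX : HasDerivAt X X' s) (hY : HasDerivAt Y Y' s) :
    HasDerivAt (fun t => form2 (J t) (X t) (Y t))
      (form2 J' (X s) (Y s) + 2 * polar2 (J s) (X s) (Y s) X' Y') s := by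
  refine ((((hJ 2 0).mul (hX.pow 2)).add ((((hJ 1 1).const_mul 2).mul hX).mul hY)).add
    ((hJ 0 2).mul (hY.pow 2))).congr_deriv ?_
  simp [form2, polar2]; ring

lemma hasDerivAt_form3 (hJ : ∀ i j, HasDerivAt (fun t => J t i j) (J' i j) s)
    (hX : HasDerivAt X X' s) (hY : HasDerivAt Y Y' s) :
    HasDerivAt (fun t => form3 (J t) (X t) (Y t))
      (form3 J' (X s) (Y s) + 3 * polar3 (J s) (X s) (Y s) X' Y') s := by
  refine (((((hJ 3 0).mul (hX.pow 3)).add ((((hJ 2 1).const_mul 3).mul (hX.pow 2)).mul hY)).add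
    ((((hJ 1 2).const_mul 3).mul hX).mul (hY.pow 2))).add
    ((hJ 0 3).mul (hY.pow 3))).congr_deriv ?_
  simp [form3, polar3]; ring

lemma hasDerivAt_form4 (hJ : ∀ i j, HasDerivAt (fun t => J t i j) (J' i j) s)
    (hX : HasDerivAt X X' s) (hY : HasDerivAt Y Y' s) :
    HasDerivAt (fun t => form4 (J t) (X t) (Y t))
      (form4 J' (X s) (Y s) + 4 * polar4 (J s) (X s) (Y s) X' Y') s := by
  refine ((((((hJ 4 0).mul (hX.pow 4)).add ((((hJ 3 1).const_mul 4).mul (hX.pow 3)).mul hY)).add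
    ((((hJ 2 2).const_mul 6).mul (hX.pow 2)).mul (hY.pow 2))).add
    ((((hJ 1 3).const_mul 4).mul hX).mul (hY.pow 3))).add
    ((hJ 0 4).mul (hY.pow 4))).congr_deriv ?_
  simp [form4, polar4]; ring

/-- Since `U` and `V` vanish at `s`, only the terms that differentiate them survive. This is the
case needed: the transversal direction of the identity is zero. -/
lemma hasDerivAt_polar2 (hJ : ∀ i j, HasDerivAt (fun t => J t i j) (J' i j) s)
    (hX : HasDerivAt X X' s) (hY : HasDerivAt Y Y' s) (hU : HasDerivAt U U' s)
    (hV : HasDerivAt V V' s) (hU0 : U s = 0) (hV0 : V s = 0) :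
    HasDerivAt (fun t => polar2 (J t) (X t) (Y t) (U t) (V t))
      (polar2 (J s) (X s) (Y s) U' V') s := by
  refine (((((hJ 2 0).mul hX).mul hU).add ((hJ 1 1).mul ((hX.mul hV).add (hY.mul hU)))).add
    (((hJ 0 2).mul hY).mul hV)).congr_deriv ?_
  simp [polar2, hU0, hV0]

lemma hasDerivAt_polar3 (hJ : ∀ i j, HasDerivAt (fun t => J t i j) (J' i j) s)
    (hX : HasDerivAt X X' s) (hY : HasDerivAt Y Y' s) (hU : HasDerivAt U U' s)
    (hV : HasDerivAt V V' s) (hU0 : U s = 0) (hV0 : V s = 0) :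
    HasDerivAt (fun t => polar3 (J t) (X t) (Y t) (U t) (V t))
      (polar3 (J s) (X s) (Y s) U' V') s := by
  refine ((((((hJ 3 0).mul (hX.pow 2)).add ((((hJ 2 1).const_mul 2).mul hX).mul hY)).add
    ((hJ 1 2).mul (hY.pow 2))).mul hU).add (((((hJ 2 1).mul (hX.pow 2)).add
    ((((hJ 1 2).const_mul 2).mul hX).mul hY)).add ((hJ 0 3).mul (hY.pow 2))).mul hV)).congr_deriv ?_
  simp [polar3, hU0, hV0]

end Derivatives

/-- The parameters of the identity. -/
def idParam : Fin 7 → ℝ := ![1, 0, 0, 1, 0, 0, 1]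

/-- Normalizations at points that converge to the base point, and that themselves converge to
the identity, give rise to an infinitesimal normalization. -/
lemma exists_isInfinitesimalNormalization {J : ℝ → ℕ → ℕ → ℝ} {J' : ℕ → ℕ → ℝ}
    (hJ : ∀ i j, HasDerivAt (fun t => J t i j) (J' i j) 0) (hK : IsStandard (J 0))
    {t : ℕ → ℝ} {θ : ℕ → Fin 7 → ℝ} (ht : Tendsto t atTop (𝓝 0)) (ht0 : ∀ n, t n ≠ 0)
    (hθ : Tendsto θ atTop (𝓝 idParam)) (h : ∀ n, IsNormalization (J (t n)) (J 0) (θ n)) :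
    ∃ η, IsInfinitesimalNormalization (J 0) J' 1 η := by
  -- The zeros live in the product of the parameter space and the time axis; they differ from the
  -- limit since `t n ≠ 0`.
  obtain ⟨⟨η, τ⟩, hd, hF⟩ := exists_tangent_direction (x := fun n => (θ n, t n))
    (x₀ := (idParam, 0)) (hθ.prodMk_nhds ht) (fun n hn => ht0 n (congrArg Prod.snd hn))
  have dJ : ∀ i j, DifferentiableAt ℝ (fun z : (Fin 7 → ℝ) × ℝ => J z.2 i j) (idParam, 0) :=
    fun i j => DifferentiableAt.comp (g := fun t => J t i j) (f := Prod.snd)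
      ((idParam, 0) : (Fin 7 → ℝ) × ℝ) (hJ i j).differentiableAt differentiableAt_snd
  have dX : ∀ (k l : Fin 7) (x y : ℝ), DifferentiableAt ℝ
      (fun z : (Fin 7 → ℝ) × ℝ => z.1 k * x + z.1 l * y) (idParam, 0) := fun k l x y => by fun_prop
  have dp : ∀ k : Fin 7, DifferentiableAt ℝ (fun z : (Fin 7 → ℝ) × ℝ => z.1 k) (idParam, 0) :=
    fun k => by fun_prop
  have vJ : ∀ i j, HasDerivAt (fun s : ℝ => J (0 + s * τ) i j) (τ * J' i j) 0 := by
    intro i j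
    have h1 : HasDerivAt (fun s : ℝ => 0 + s * τ) τ 0 := by
      simpa using ((hasDerivAt_id (0 : ℝ)).mul_const τ).const_add 0
    have := HasDerivAt.comp (h₂ := fun t => J t i j) (0 : ℝ) (by simpa using hJ i j) h1
    simpa [mul_comm, Function.comp_def] using this
  have vp : ∀ k : Fin 7, HasDerivAt (fun s : ℝ => idParam k + s * η k) (η k) 0 := fun k => by
    simpa using ((hasDerivAt_id (0 : ℝ)).mul_const (η k)).const_add (idParam k)
  have vX : ∀ (k l : Fin 7) (x y : ℝ), HasDerivAt
      (fun s : ℝ => (idParam k + s * η k) * x + (idParam l + s * η l) * y) (η k * x + η l * y) 0 :=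
    fun k l x y => ((vp k).mul_const x).add ((vp l).mul_const y)
  have hinf : IsInfinitesimalNormalization (J 0) J' τ η := by
    constructor <;> intro x y
    · refine hF (fun z => form2 (J z.2) (z.1 0 * x + z.1 1 * y) (z.1 2 * x + z.1 3 * y)
        - form2 (J 0) x y) ?_ (fun n => (h n).two x y) _ ?_
      · exact (differentiableAt_form2 dJ (dX _ _ _ _) (dX _ _ _ _)).sub_const _
      · refine ((hasDerivAt_form2 vJ (vX 0 1 x y) (vX 2 3 x y)).sub_const _).congr_deriv ?_
        simp [idParam, form2]; ring
    · refine hF (fun z => form3 (J z.2) (z.1 0 * x + z.1 1 * y) (z.1 2 * x + z.1 3 * y)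
        + 3 * polar2 (J z.2) (z.1 0 * x + z.1 1 * y) (z.1 2 * x + z.1 3 * y) (z.1 4) (z.1 5)
          * form2 (J 0) x y - z.1 6 * form3 (J 0) x y) ?_ (fun n => (h n).three x y) _ ?_
      · exact ((differentiableAt_form3 dJ (dX _ _ _ _) (dX _ _ _ _)).add
          (((differentiableAt_polar2 dJ (dX _ _ _ _) (dX _ _ _ _) (dp _) (dp _)).const_mul
            3).mul_const _)).sub ((dp _).mul_const _)
      · refine (((hasDerivAt_form3 vJ (vX 0 1 x y) (vX 2 3 x y)).add
          (((hasDerivAt_polar2 vJ (vX 0 1 x y) (vX 2 3 x y) (vp 4) (vp 5) (by simp [idParam])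
            (by simp [idParam])).const_mul 3).mul_const (form2 (J 0) x y))).sub
            ((vp 6).mul_const (form3 (J 0) x y))).congr_deriv ?_
        simp [idParam, form3]; ring
    · refine hF (fun z => form4 (J z.2) (z.1 0 * x + z.1 1 * y) (z.1 2 * x + z.1 3 * y)
        + 6 * polar3 (J z.2) (z.1 0 * x + z.1 1 * y) (z.1 2 * x + z.1 3 * y) (z.1 4) (z.1 5)
          * form2 (J 0) x y
        + 3 * form2 (J z.2) (z.1 4) (z.1 5) * form2 (J 0) x y ^ 2
        + 4 * z.1 6 * polar2 (J z.2) (z.1 0 * x + z.1 1 * y) (z.1 2 * x + z.1 3 * y) (z.1 4) (z.1 5)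
          * form3 (J 0) x y
        - z.1 6 ^ 2 * form4 (J 0) x y) ?_ (fun n => (h n).four x y) _ ?_
      · exact ((((differentiableAt_form4 dJ (dX _ _ _ _) (dX _ _ _ _)).add
          (((differentiableAt_polar3 dJ (dX _ _ _ _) (dX _ _ _ _) (dp _) (dp _)).const_mul
            6).mul_const _)).add
          (((differentiableAt_form2 dJ (dp _) (dp _)).const_mul 3).mul_const _)).add
          ((((dp _).const_mul 4).mul
            (differentiableAt_polar2 dJ (dX _ _ _ _) (dX _ _ _ _) (dp _) (dp _))).mul_const _)).sub
          (((dp _).pow 2).mul_const _)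
      · refine (((((hasDerivAt_form4 vJ (vX 0 1 x y) (vX 2 3 x y)).add
          (((hasDerivAt_polar3 vJ (vX 0 1 x y) (vX 2 3 x y) (vp 4) (vp 5) (by simp [idParam])
            (by simp [idParam])).const_mul 6).mul_const (form2 (J 0) x y))).add
          (((hasDerivAt_form2 vJ (vp 4) (vp 5)).const_mul 3).mul_const
            (form2 (J 0) x y ^ 2))).add
          ((((vp 6).const_mul 4).mul (hasDerivAt_polar2 vJ (vX 0 1 x y) (vX 2 3 x y) (vp 4) (vp 5)
            (by simp [idParam]) (by simp [idParam]))).mul_const (form3 (J 0) x y))).sub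
          (((vp 6).pow 2).mul_const (form4 (J 0) x y))).congr_deriv ?_
        simp [idParam, form4, form2, polar2]; ring
  -- If `τ` were zero, `η` would be an infinitesimal symmetry, hence zero, and the limit direction
  -- would vanish.
  have hτ : τ ≠ 0 := by
    rintro rfl
    exact hd (by rw [hinf.eq_zero hK]; rfl)
  exact ⟨_, by simpa [hτ] using hinf.smul τ⁻¹⟩

/-! ### Compactness of normalizations and symmetries of the standard jet -/

/-- The dual of an orthonormal basis for a quadratic form. -/
lemma orthonormal_expansion {h k l a b c d u v : ℝ}
    (h1 : h * a ^ 2 + 2 * k * a * c + l * c ^ 2 = 1)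
    (h2 : h * a * b + k * (a * d + c * b) + l * c * d = 0)
    (h3 : h * b ^ 2 + 2 * k * b * d + l * d ^ 2 = 1) :
    u = (h * a * u + k * (a * v + c * u) + l * c * v) * a
        + (h * b * u + k * (b * v + d * u) + l * d * v) * b ∧
    v = (h * a * u + k * (a * v + c * u) + l * c * v) * c
        + (h * b * u + k * (b * v + d * u) + l * d * v) * d := by
  -- With A the basis matrix and H the form, AᵀHA = 1 says that AᵀH is a left inverse of A. It is
  -- then a right inverse, and A(AᵀH) = 1 is the expansion.
  have hm : (!![a, c; b, d] * !![h, k; k, l]) * !![a, b; c, d] = (1 : Matrix (Fin 2) (Fin 2) ℝ) := by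
    ext i j
    fin_cases i <;> fin_cases j <;> simp [Matrix.mul_apply, Fin.sum_univ_two] <;> linarith
  have hm' := mul_eq_one_comm.1 hm
  have e00 := congrFun (congrFun hm' 0) 0
  have e01 := congrFun (congrFun hm' 0) 1
  have e10 := congrFun (congrFun hm' 1) 0
  have e11 := congrFun (congrFun hm' 1) 1
  simp [Matrix.mul_apply, Fin.sum_univ_two] at e00 e01 e10 e11
  exact ⟨by linear_combination -u * e00 - v * e01, by linear_combination -u * e10 - v * e11⟩

/-- A normalization in terms of its linear part on the tangent plane. -/
noncomputable def paramOfLinear (J : ℕ → ℕ → ℝ) (a : Fin 4 → ℝ) : Fin 7 → ℝ :=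
  let C := fun x y => form3 J (a 0 * x + a 1 * y) (a 2 * x + a 3 * y)
  let m := (4 * C 1 0 - C 1 1 - C 1 (-1)) / 8
  ![a 0, a 1, a 2, a 3, (m - C 1 0) / 3 * a 0 - C 0 1 / 3 * a 1,
    (m - C 1 0) / 3 * a 2 - C 0 1 / 3 * a 3, m]

lemma continuous_paramOfLinear :
    Continuous fun z : (ℕ → ℕ → ℝ) × (Fin 4 → ℝ) => paramOfLinear z.1 z.2 := by
  refine continuous_pi fun i => ?_
  fin_cases i <;> simp [paramOfLinear, form3] <;> fun_prop

namespace IsNormalization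

variable {J K : ℕ → ℕ → ℝ} {θ : Fin 7 → ℝ}

/-- The cubic equation splits the pulled-back cubic into a multiple of x³ - 3xy² and a linear form
times x² + y². Four values give the multiple `θ 6` and the linear form, which is the pairing with
`(θ 4, θ 5)`; the columns of the linear part are orthonormal for `form2 J`, so this pairing recovers
the vector. Hence control of the linear part alone controls all of `θ`. -/
lemma eq_paramOfLinear (hK : IsStandard K) (h : IsNormalization J K θ) :
    θ = paramOfLinear J ![θ 0, θ 1, θ 2, θ 3] := by
  have h2 := h.two
  have h3 := h.three
  simp only [polar2, form2, hK.a20, hK.a11, hK.a02] at h2 h3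
  simp only [show ∀ x y, form3 K x y = x ^ 3 - 3 * x * y ^ 2 by
    intro x y; simp only [form3, hK.a30, hK.a21, hK.a12, hK.a03]; ring] at h3
  have a1 := h2 1 0
  have a2 := h2 0 1
  have a3 := h2 1 1
  have b1 := h3 1 0
  have b2 := h3 0 1
  have b3 := h3 1 1
  have b4 := h3 1 (-1)
  obtain ⟨e1, e2⟩ := orthonormal_expansion (u := θ 4) (v := θ 5) (h := J 2 0) (k := J 1 1)
    (l := J 0 2) (a := θ 0) (b := θ 1) (c := θ 2) (d := θ 3)
    (by linear_combination a1) (by linear_combination (a3 - a1 - a2) / 2)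
    (by linear_combination a2)
  have c6 : θ 6 = (4 * form3 J (θ 0 * 1 + θ 1 * 0) (θ 2 * 1 + θ 3 * 0)
      - form3 J (θ 0 * 1 + θ 1 * 1) (θ 2 * 1 + θ 3 * 1)
      - form3 J (θ 0 * 1 + θ 1 * (-1)) (θ 2 * 1 + θ 3 * (-1))) / 8 := by
    linear_combination (b3 + b4 - 4 * b1) / 8
  funext i
  fin_cases i
  · rfl
  · rfl
  · rfl
  · rfl
  · simp only [paramOfLinear, Matrix.cons_val, Fin.reduceFinMk]
    rw [← c6]
    linear_combination e1 + b1 / 3 * θ 0 + b2 / 3 * θ 1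
  · simp only [paramOfLinear, Matrix.cons_val, Fin.reduceFinMk]
    rw [← c6]
    linear_combination e2 + b1 / 3 * θ 2 + b2 / 3 * θ 3
  · exact c6

lemma of_tendsto {Js : ℕ → ℕ → ℕ → ℝ} {θs : ℕ → Fin 7 → ℝ} (hJ : Tendsto Js atTop (𝓝 J))
    (hθ : Tendsto θs atTop (𝓝 θ)) (h : ∀ n, IsNormalization (Js n) K (θs n)) :
    IsNormalization J K θ := by
  have key : ∀ F : (ℕ → ℕ → ℝ) × (Fin 7 → ℝ) → ℝ, Continuous F → (∀ n, F (Js n, θs n) = 0) →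
      F (J, θ) = 0 := fun F hF h0 =>
    tendsto_nhds_unique ((hF.tendsto _).comp (hJ.prodMk_nhds hθ)) (by simp [Function.comp_def, h0])
  constructor <;> intro x y
  · refine key (fun z => form2 z.1 (z.2 0 * x + z.2 1 * y) (z.2 2 * x + z.2 3 * y) - form2 K x y)
      ?_ fun n => (h n).two x y
    unfold form2; fun_prop
  · refine key (fun z => form3 z.1 (z.2 0 * x + z.2 1 * y) (z.2 2 * x + z.2 3 * y)
      + 3 * polar2 z.1 (z.2 0 * x + z.2 1 * y) (z.2 2 * x + z.2 3 * y) (z.2 4) (z.2 5) * form2 K x y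
      - z.2 6 * form3 K x y) ?_ fun n => (h n).three x y
    unfold form3 polar2; fun_prop
  · refine key (fun z => form4 z.1 (z.2 0 * x + z.2 1 * y) (z.2 2 * x + z.2 3 * y)
      + 6 * polar3 z.1 (z.2 0 * x + z.2 1 * y) (z.2 2 * x + z.2 3 * y) (z.2 4) (z.2 5) * form2 K x y
      + 3 * form2 z.1 (z.2 4) (z.2 5) * form2 K x y ^ 2
      + 4 * z.2 6 * polar2 z.1 (z.2 0 * x + z.2 1 * y) (z.2 2 * x + z.2 3 * y) (z.2 4) (z.2 5)
        * form3 K x y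
      - z.2 6 ^ 2 * form4 K x y) ?_ fun n => (h n).four x y
    unfold form4 polar3 form2 polar2; fun_prop

/-- A normalization of a standard jet to itself is an orthogonal transformation of the tangent
plane. -/
lemma self_eq (hK : IsStandard K) (h : IsNormalization K K θ) (h0 : 0 ≤ θ 6) :
    θ 0 ^ 2 + θ 1 ^ 2 = 1 ∧ θ 0 * θ 2 + θ 1 * θ 3 = 0 ∧ θ 2 ^ 2 + θ 3 ^ 2 = 1 ∧
      θ 4 = 0 ∧ θ 5 = 0 ∧ θ 6 = 1 := by
  have h2 := h.two
  have h3 := h.three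
  simp only [polar2, form2, form3, hK.a20, hK.a11, hK.a02, hK.a30, hK.a21, hK.a12, hK.a03] at h2 h3
  have a1 := h2 1 0
  have a2 := h2 0 1
  have a3 := h2 1 1
  have b1 := h3 1 0
  have b2 := h3 0 1
  have b3 := h3 1 1
  have b4 := h3 1 (-1)
  clear h2 h3
  generalize θ 0 = a, θ 1 = b, θ 2 = c, θ 3 = d, θ 4 = u, θ 5 = v, θ 6 = m at *
  replace a3 : a * b + c * d = 0 := by linear_combination (a3 - a1 - a2) / 2
  replace a1 : a ^ 2 + c ^ 2 - 1 = 0 := by linear_combination a1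
  replace a2 : b ^ 2 + d ^ 2 - 1 = 0 := by linear_combination a2
  have hm : !![a, c; b, d] * !![a, b; c, d] = (1 : Matrix (Fin 2) (Fin 2) ℝ) := by
    ext i j
    fin_cases i <;> fin_cases j <;> simp [Matrix.mul_apply, Fin.sum_univ_two] <;> linarith
  have hm' := mul_eq_one_comm.1 hm
  have e00 := congrFun (congrFun hm' 0) 0
  have e01 := congrFun (congrFun hm' 0) 1
  have e11 := congrFun (congrFun hm' 1) 1
  simp [Matrix.mul_apply, Fin.sum_univ_two] at e00 e01 e11
  -- An orthogonal matrix is a rotation or a reflection, according to its determinant.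
  have hbd : (b = -c ∧ d = a) ∨ (b = c ∧ d = -a) := by
    have h1 : b = -(a * d - b * c) * c := by linear_combination a * a3 - b * a1
    have h2 : d = (a * d - b * c) * a := by linear_combination c * a3 - d * a1
    have h3 : (a * d - b * c - 1) * (a * d - b * c + 1) = 0 := by
      linear_combination (b ^ 2 + d ^ 2) * a1 + a2 - (a * b + c * d) * a3
    rcases mul_eq_zero.1 h3 with h | h
    · rw [sub_eq_zero.1 h] at h1 h2
      exact .inl ⟨by linarith, by linarith⟩
    · rw [eq_neg_of_add_eq_zero_left h] at h1 h2
      exact .inr ⟨by linarith, by linarith⟩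
  -- An orthogonal map keeps the cubic harmonic, so the term with factor x² + y² vanishes, which
  -- kills the transversal part.
  have key : a * u + c * v = 0 ∧ c * u - a * v = 0 ∧ a ^ 3 - 3 * a * c ^ 2 = m ∧
      c ^ 3 - 3 * a ^ 2 * c = 0 := by
    rcases hbd with ⟨rfl, rfl⟩ | ⟨rfl, rfl⟩
    · have h1 : d * u + c * v = 0 := by linear_combination ((b3 + b4) / 4 + b1) / 6
      have h2 : c * u - d * v = 0 := by linear_combination -(b3 - b4 + 4 * b2) / 24
      exact ⟨h1, h2, by linear_combination b1 - 3 * h1, by linear_combination -b2 - 3 * h2⟩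
    · have h1 : a * u + b * v = 0 := by linear_combination ((b3 + b4) / 4 + b1) / 6
      have h2 : b * u - a * v = 0 := by linear_combination (b3 - b4 + 4 * b2) / 24
      exact ⟨h1, h2, by linear_combination b1 - 3 * h1, by linear_combination b2 - 3 * h2⟩
  obtain ⟨k1, k2, k3, k4⟩ := key
  refine ⟨by linarith, by linarith, by linarith, ?_, ?_, ?_⟩
  · linear_combination a * k1 + c * k2 - u * a1
  · linear_combination c * k1 - a * k2 - v * a1
  -- For z = a + ic the last two relations say Re z³ = m and Im z³ = 0, with |z| = 1. The sign
  -- hypothesis on the scale excludes m = -1.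
  · have : (m - 1) * (m + 1) = 0 := by
      rw [← k3]
      linear_combination (-(c ^ 3 - 3 * a ^ 2 * c)) * k4
        + ((a ^ 2 + c ^ 2) ^ 2 + (a ^ 2 + c ^ 2) + 1) * a1
    exact (mul_eq_zero.1 this).elim sub_eq_zero.1 fun h => absurd h (by linarith)

/-- Composition of a normalization with the inverse of a symmetry of the standard jet. -/
lemma comp_symm {τ : Fin 7 → ℝ} (hK : IsStandard K) (h : IsNormalization J K θ)
    (hτ : IsNormalization K K τ) (h0 : 0 ≤ τ 6) :
    IsNormalization J K ![θ 0 * τ 0 + θ 1 * τ 1, θ 0 * τ 2 + θ 1 * τ 3,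
      θ 2 * τ 0 + θ 3 * τ 1, θ 2 * τ 2 + θ 3 * τ 3, θ 4, θ 5, θ 6] := by
  obtain ⟨e1, e2, e3, e4, e5, e6⟩ := hτ.self_eq hK h0
  -- The linear part of `τ` is orthogonal, so its transpose is its inverse, and each form of `K` is
  -- invariant under that transpose.
  have hx : ∀ x y, τ 0 * (τ 0 * x + τ 2 * y) + τ 1 * (τ 1 * x + τ 3 * y) = x := fun x y => by
    linear_combination x * e1 + y * e2
  have hy : ∀ x y, τ 2 * (τ 0 * x + τ 2 * y) + τ 3 * (τ 1 * x + τ 3 * y) = y := fun x y => by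
    linear_combination x * e2 + y * e3
  have k2 : ∀ x y, form2 K (τ 0 * x + τ 2 * y) (τ 1 * x + τ 3 * y) = form2 K x y := fun x y => by
    have := hτ.two (τ 0 * x + τ 2 * y) (τ 1 * x + τ 3 * y)
    rw [hx, hy] at this
    linarith
  have k3 : ∀ x y, form3 K (τ 0 * x + τ 2 * y) (τ 1 * x + τ 3 * y) = form3 K x y := fun x y => by
    have := hτ.three (τ 0 * x + τ 2 * y) (τ 1 * x + τ 3 * y)
    rw [hx, hy, e4, e5, e6] at this
    simp only [polar2] at this
    linarith
  have k4 : ∀ x y, form4 K (τ 0 * x + τ 2 * y) (τ 1 * x + τ 3 * y) = form4 K x y := fun x y => by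
    have := hτ.four (τ 0 * x + τ 2 * y) (τ 1 * x + τ 3 * y)
    rw [hx, hy, e4, e5, e6] at this
    simp only [polar2, polar3] at this
    have h00 : form2 K 0 0 = 0 := by simp [form2]
    rw [h00] at this
    linarith
  have l0 : ∀ x y, (θ 0 * τ 0 + θ 1 * τ 1) * x + (θ 0 * τ 2 + θ 1 * τ 3) * y
      = θ 0 * (τ 0 * x + τ 2 * y) + θ 1 * (τ 1 * x + τ 3 * y) := fun x y => by ring
  have l1 : ∀ x y, (θ 2 * τ 0 + θ 3 * τ 1) * x + (θ 2 * τ 2 + θ 3 * τ 3) * y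
      = θ 2 * (τ 0 * x + τ 2 * y) + θ 3 * (τ 1 * x + τ 3 * y) := fun x y => by ring
  constructor <;> intro x y <;> simp only [Matrix.cons_val] <;> rw [l0, l1]
  · rw [← k2 x y]; exact h.two _ _
  · rw [← k2 x y, ← k3 x y]; exact h.three _ _
  · rw [← k2 x y, ← k3 x y, ← k4 x y]; exact h.four _ _

end IsNormalization

/-- Normalizations at a sequence of jets that converges to a standard jet can be chosen such that a
subsequence converges to the identity. -/
lemma exists_normalizations_tendsto {J : ℕ → ℕ → ℕ → ℝ} {K : ℕ → ℕ → ℝ} (hK : IsStandard K)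
    (hJ : Tendsto J atTop (𝓝 K)) (h : ∀ n, ∃ θ, 0 ≤ θ 6 ∧ IsNormalization (J n) K θ) :
    ∃ φ : ℕ → ℕ, StrictMono φ ∧ ∃ θ : ℕ → Fin 7 → ℝ,
      (∀ n, IsNormalization (J (φ n)) K (θ n)) ∧ Tendsto θ atTop (𝓝 idParam) := by
  choose θ hpos hθ using h
  have hJ' : ∀ i j, Tendsto (fun n => J n i j) atTop (𝓝 (K i j)) := fun i j =>
    tendsto_pi_nhds.1 (tendsto_pi_nhds.1 hJ i) j
  have hev : ∀ᶠ n in atTop, ![θ n 0, θ n 1, θ n 2, θ n 3] ∈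
      Set.Icc (fun _ => -2 : Fin 4 → ℝ) (fun _ => 2) := by
    have j20 := (hJ' 2 0).eventually_const_lt (u := 3 / 4) (by rw [hK.a20]; norm_num)
    have j02 := (hJ' 0 2).eventually_const_lt (u := 3 / 4) (by rw [hK.a02]; norm_num)
    have j11 := (hJ' 1 1).eventually_const_lt (u := -1 / 4) (by rw [hK.a11]; norm_num)
    have j11' := (hJ' 1 1).eventually_lt_const (u := 1 / 4) (by rw [hK.a11]; norm_num)
    filter_upwards [j20, j02, j11, j11'] with n h20 h02 h11 h11'
    -- Near the standard Hessian the form dominates a fixed multiple of X² + Y², so its unit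
    -- vectors, in particular the columns of the linear part, stay in a fixed box.
    have hb : ∀ X Y, form2 (J n) X Y = 1 → (-2 ≤ X ∧ X ≤ 2) ∧ (-2 ≤ Y ∧ Y ≤ 2) := by
      intro X Y hXY
      have : X ^ 2 + Y ^ 2 ≤ 4 := by
        rw [form2] at hXY
        nlinarith [mul_nonneg (sub_nonneg.2 h20.le) (sq_nonneg X),
          mul_nonneg (sub_nonneg.2 h02.le) (sq_nonneg Y),
          mul_nonneg (sub_nonneg.2 h11.le) (sq_nonneg (X + Y)),
          mul_nonneg (sub_nonneg.2 h11'.le) (sq_nonneg (X - Y)), sq_nonneg X, sq_nonneg Y]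
      exact ⟨⟨by nlinarith, by nlinarith⟩, ⟨by nlinarith, by nlinarith⟩⟩
    have t1 := (hθ n).two 1 0
    have t2 := (hθ n).two 0 1
    have k1 : form2 K 1 0 = 1 := by simp [form2, hK.a20]
    have k2 : form2 K 0 1 = 1 := by simp [form2, hK.a02]
    rw [k1, sub_eq_zero] at t1
    rw [k2, sub_eq_zero] at t2
    simp only [mul_one, mul_zero, add_zero, zero_add] at t1 t2
    have b1 := hb _ _ t1
    have b2 := hb _ _ t2
    constructor <;> intro i <;> fin_cases i <;> simp <;> tauto
  obtain ⟨a, -, φ, hφ, hlim⟩ := isCompact_Icc.tendsto_subseq' hev.frequently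
  have hJφ : Tendsto (J ∘ φ) atTop (𝓝 K) := hJ.comp hφ.tendsto_atTop
  have hθφ : Tendsto (θ ∘ φ) atTop (𝓝 (paramOfLinear K a)) := by
    refine ((continuous_paramOfLinear.tendsto _).comp (hJφ.prodMk_nhds hlim)).congr fun n => ?_
    exact ((hθ (φ n)).eq_paramOfLinear hK).symm
  set τ := paramOfLinear K a
  have hc : ∀ i, Tendsto (fun n => θ (φ n) i) atTop (𝓝 (τ i)) := tendsto_pi_nhds.1 hθφ
  have hτ : IsNormalization K K τ := IsNormalization.of_tendsto hJφ hθφ fun n => hθ (φ n)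
  have h6 : 0 ≤ τ 6 := ge_of_tendsto' (hc 6) fun n => hpos (φ n)
  obtain ⟨e1, e2, e3, e4, e5, e6⟩ := hτ.self_eq hK h6
  refine ⟨φ, hφ, _, fun n => (hθ (φ n)).comp_symm hK hτ h6, tendsto_pi_nhds.2 fun i => ?_⟩
  have hl : ∀ k l m n : Fin 7, Tendsto (fun r => θ (φ r) k * τ m + θ (φ r) l * τ n) atTop
      (𝓝 (τ k * τ m + τ l * τ n)) := fun k l m n =>
    ((hc k).mul_const _).add ((hc l).mul_const _)
  fin_cases i
  · have := hl 0 1 0 1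
    rwa [show τ 0 * τ 0 + τ 1 * τ 1 = 1 by linarith] at this
  · have := hl 0 1 2 3
    rwa [show τ 0 * τ 2 + τ 1 * τ 3 = 0 by linarith] at this
  · have := hl 2 3 0 1
    rwa [show τ 2 * τ 0 + τ 3 * τ 1 = 0 by linarith] at this
  · have := hl 2 3 2 3
    rwa [show τ 2 * τ 2 + τ 3 * τ 3 = 1 by linarith] at this
  · have := hc 4
    rwa [e4] at this
  · have := hc 5
    rwa [e5] at this
  · have := hc 6
    rwa [e6] at this

/-! ### Comparison of two graph representations -/

/-- The derivatives of `s ↦ s * w`. -/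
def lineChain (w : ℝ) (k : ℕ) (s : ℝ) : ℝ :=
  match k with
  | 0 => s * w
  | 1 => w
  | _ => 0

lemma isDerivChain_lineChain (w : ℝ) : IsDerivChain (lineChain w) := by
  intro k _
  refine .of_forall fun s => ?_
  match k with
  | 0 => exact ((hasDerivAt_id s).mul_const w).congr_deriv (by simp [lineChain])
  | 1 => exact hasDerivAt_const s w
  | _ + 2 => exact hasDerivAt_const s 0

/-- The derivatives of an affine combination of three functions. -/
def affineChain (a b c d : ℝ) (x y z : ℕ → ℝ → ℝ) (k : ℕ) (s : ℝ) : ℝ :=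
  a * x k s + b * y k s + c * z k s + if k = 0 then d else 0

lemma IsDerivChain.affineChain {x y z : ℕ → ℝ → ℝ} (hx : IsDerivChain x) (hy : IsDerivChain y)
    (hz : IsDerivChain z) (a b c d : ℝ) : IsDerivChain (affineChain a b c d x y z) := by
  intro k hk
  filter_upwards [hx k hk, hy k hk, hz k hk] with s h1 h2 h3
  refine ((((h1.const_mul a).add (h2.const_mul b)).add (h3.const_mul c)).add_const _).congr_deriv ?_
  simp [AffineSurface.affineChain]

lemma HasStandardJet.isStandard {f : ℝ × ℝ → ℝ} (h : HasStandardJet f) :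
    IsStandard fun i j => partials f i j (0, 0) :=
  ⟨h.a20, h.a11, h.a02, h.a30, h.a21, h.a12, h.a03⟩

/-- The comparison of the derivatives up to order four of the two functions whose graphs represent
the same surface in two affine coordinate systems. -/
lemma jet_comparison {F G : ℕ → ℕ → ℝ × ℝ → ℝ} {U V : Set (ℝ × ℝ)} (hU : IsOpen U)
    (hV : IsOpen V) (hF : IsJetFamily F U) (hG : IsJetFamily G V) {q : ℝ × ℝ} (hq : q ∈ U)
    (h0 : (0, 0) ∈ V) (g00 : G 0 0 (0, 0) = 0) (g10 : G 1 0 (0, 0) = 0) (g01 : G 0 1 (0, 0) = 0)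
    {M : Matrix (Fin 3) (Fin 3) ℝ}
    (h : ∀ᶠ v in 𝓝 (0 : Fin 3 → ℝ), v 2 = G 0 0 (v 0, v 1) →
      (M *ᵥ v) 2 + F 0 0 q = F 0 0 ((M *ᵥ v) 0 + q.1, (M *ᵥ v) 1 + q.2))
    (w₁ w₂ : ℝ) {X Y e₂ e₃ e₄ l : ℝ} {J : ℕ → ℕ → ℝ} (hJ : J = fun i j => F i j q)
    (hX : X = M 0 0 * w₁ + M 0 1 * w₂) (hY : Y = M 1 0 * w₁ + M 1 1 * w₂)
    (he₂ : e₂ = form2 (fun i j => G i j (0, 0)) w₁ w₂)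
    (he₃ : e₃ = form3 (fun i j => G i j (0, 0)) w₁ w₂)
    (he₄ : e₄ = form4 (fun i j => G i j (0, 0)) w₁ w₂)
    (hl : l = M 2 2 - J 1 0 * M 0 2 - J 0 1 * M 1 2) :
    M 2 0 * w₁ + M 2 1 * w₂ = J 1 0 * X + J 0 1 * Y ∧
    l * e₂ = form2 J X Y ∧
    l * e₃ = form3 J X Y + 3 * polar2 J X Y (M 0 2) (M 1 2) * e₂ ∧
    l * e₄ = form4 J X Y + 6 * polar3 J X Y (M 0 2) (M 1 2) * e₂
      + 3 * form2 J (M 0 2) (M 1 2) * e₂ ^ 2 + 4 * polar2 J X Y (M 0 2) (M 1 2) * e₃ := by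
  -- Both charts are compared along the curve over the line s ↦ s(w₁, w₂). Since a form is
  -- determined by its values, no mixed derivatives need separate treatment.
  set φ := compDeriv G (lineChain w₁) (lineChain w₂) with hφ
  have hw₁ := isDerivChain_lineChain w₁
  have hw₂ := isDerivChain_lineChain w₂
  have cφ : IsDerivChain φ :=
    isDerivChain_compDeriv hV hG hw₁ hw₂ (by simpa [lineChain] using h0)
  have φ0 : φ 0 0 = 0 := by simp [hφ, compDeriv, lineChain, g00]
  have φ1 : φ 1 0 = 0 := by simp [hφ, compDeriv, lineChain, g10, g01]
  have φ2 : φ 2 0 = e₂ := by simp [hφ, compDeriv, lineChain, he₂, form2]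
  have φ3 : φ 3 0 = e₃ := by simp [hφ, compDeriv, lineChain, he₃, form3]
  have φ4 : φ 4 0 = e₄ := by simp [hφ, compDeriv, lineChain, he₄, form4]
  set x := affineChain (M 0 0) (M 0 1) (M 0 2) q.1 (lineChain w₁) (lineChain w₂) φ with hx
  set y := affineChain (M 1 0) (M 1 1) (M 1 2) q.2 (lineChain w₁) (lineChain w₂) φ with hy
  set z := affineChain (M 2 0) (M 2 1) (M 2 2) (F 0 0 q) (lineChain w₁) (lineChain w₂) φ with hz
  have cx : IsDerivChain x := hw₁.affineChain hw₂ cφ _ _ _ _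
  have cy : IsDerivChain y := hw₁.affineChain hw₂ cφ _ _ _ _
  have cz : IsDerivChain z := hw₁.affineChain hw₂ cφ _ _ _ _
  have hxy : (x 0 0, y 0 0) = q := by simp [hx, hy, affineChain, lineChain, φ0]
  have cc : IsDerivChain (compDeriv F x y) := isDerivChain_compDeriv hU hF cx cy (by rwa [hxy])
  have hcurve : ContinuousAt (fun s : ℝ => ![s * w₁, s * w₂, φ 0 s]) 0 := by
    refine continuousAt_pi.2 fun i => ?_
    fin_cases i
    · exact (continuous_mul_const w₁).continuousAt
    · exact (continuous_mul_const w₂).continuousAt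
    · exact cφ.continuousAt
  have hcurve0 : ![(0 : ℝ) * w₁, 0 * w₂, φ 0 0] = 0 := by
    rw [φ0]; funext i; fin_cases i <;> simp
  have heq : z 0 =ᶠ[𝓝 0] compDeriv F x y 0 := by
    have := hcurve.tendsto
    rw [hcurve0] at this
    filter_upwards [this.eventually h] with s hs
    have := hs rfl
    simp only [Matrix.mulVec, dotProduct, Fin.sum_univ_three, Matrix.cons_val] at this
    simpa [hz, hx, hy, compDeriv, affineChain, lineChain] using this
  have hev := fun k hk => (cz.eventuallyEq cc heq k hk).eq_of_nhds
  have E1 := hev 1 (by norm_num)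
  have E2 := hev 2 (by norm_num)
  have E3 := hev 3 (by norm_num)
  have E4 := hev 4 (by norm_num)
  have x1 : x 1 0 = X := by simp [hx, affineChain, lineChain, φ1, hX]
  have y1 : y 1 0 = Y := by simp [hy, affineChain, lineChain, φ1, hY]
  have x2 : x 2 0 = M 0 2 * e₂ := by simp [hx, affineChain, lineChain, φ2]
  have y2 : y 2 0 = M 1 2 * e₂ := by simp [hy, affineChain, lineChain, φ2]
  have x3 : x 3 0 = M 0 2 * e₃ := by simp [hx, affineChain, lineChain, φ3]
  have y3 : y 3 0 = M 1 2 * e₃ := by simp [hy, affineChain, lineChain, φ3]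
  have x4 : x 4 0 = M 0 2 * e₄ := by simp [hx, affineChain, lineChain, φ4]
  have y4 : y 4 0 = M 1 2 * e₄ := by simp [hy, affineChain, lineChain, φ4]
  have z1 : z 1 0 = M 2 0 * w₁ + M 2 1 * w₂ := by simp [hz, affineChain, lineChain, φ1]
  have z2 : z 2 0 = M 2 2 * e₂ := by simp [hz, affineChain, lineChain, φ2]
  have z3 : z 3 0 = M 2 2 * e₃ := by simp [hz, affineChain, lineChain, φ3]
  have z4 : z 4 0 = M 2 2 * e₄ := by simp [hz, affineChain, lineChain, φ4]
  simp only [compDeriv, hxy, x1, y1, x2, y2, x3, y3, x4, y4, z1, z2, z3, z4] at E1 E2 E3 E4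
  rw [hl, hJ]
  simp only [form2, form3, form4, polar2, polar3]
  exact ⟨E1, by linear_combination E2, by linear_combination E3, by linear_combination E4⟩

lemma form2_pos {J : ℕ → ℕ → ℝ} (h1 : 0 < J 2 0) (h2 : 0 < J 2 0 * J 0 2 - J 1 1 ^ 2) (x y : ℝ) :
    0 ≤ form2 J x y ∧ (form2 J x y = 0 → x = 0 ∧ y = 0) := by
  have h : J 2 0 * form2 J x y
      = (J 2 0 * x + J 1 1 * y) ^ 2 + (J 2 0 * J 0 2 - J 1 1 ^ 2) * y ^ 2 := by
    rw [form2]; ring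
  have h3 : 0 ≤ (J 2 0 * J 0 2 - J 1 1 ^ 2) * y ^ 2 := mul_nonneg h2.le (sq_nonneg y)
  refine ⟨nonneg_of_mul_nonneg_right (by rw [h]; positivity) h1, fun h0 => ?_⟩
  rw [h0, mul_zero] at h
  have hy : y = 0 := by
    have : (J 2 0 * J 0 2 - J 1 1 ^ 2) * y ^ 2 = 0 := by nlinarith [sq_nonneg (J 2 0 * x + J 1 1 * y)]
    simpa [h2.ne'] using this
  subst hy
  have : (J 2 0 * x) ^ 2 = 0 := by linarith
  have : J 2 0 * x = 0 := by simpa using this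
  exact ⟨(mul_eq_zero.1 this).resolve_left h1.ne', rfl⟩

/-- Two affine coordinate systems in which a surface is a graph, the second one with a standard
jet, differ by a normalization of the derivatives in the first system. -/
lemma exists_isNormalization {F G : ℕ → ℕ → ℝ × ℝ → ℝ} {U V : Set (ℝ × ℝ)} (hU : IsOpen U)
    (hV : IsOpen V) (hF : IsJetFamily F U) (hG : IsJetFamily G V) {q : ℝ × ℝ} (hq : q ∈ U)
    (h0 : (0, 0) ∈ V) (g00 : G 0 0 (0, 0) = 0) (g10 : G 1 0 (0, 0) = 0) (g01 : G 0 1 (0, 0) = 0)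
    (hK : IsStandard fun i j => G i j (0, 0)) (hF1 : 0 < F 2 0 q)
    (hF2 : 0 < F 2 0 q * F 0 2 q - F 1 1 q ^ 2)
    {M : Matrix (Fin 3) (Fin 3) ℝ} (hM : M.det ≠ 0)
    (h : ∀ᶠ v in 𝓝 (0 : Fin 3 → ℝ), v 2 = G 0 0 (v 0, v 1) →
      (M *ᵥ v) 2 + F 0 0 q = F 0 0 ((M *ᵥ v) 0 + q.1, (M *ᵥ v) 1 + q.2)) :
    ∃ θ : Fin 7 → ℝ, 0 ≤ θ 6 ∧
      IsNormalization (fun i j => F i j q) (fun i j => G i j (0, 0)) θ := by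
  set J : ℕ → ℕ → ℝ := fun i j => F i j q with hJ
  set K : ℕ → ℕ → ℝ := fun i j => G i j (0, 0) with hKdef
  set l := M 2 2 - J 1 0 * M 0 2 - J 0 1 * M 1 2 with hl
  have key := fun w₁ w₂ => jet_comparison hU hV hF hG hq h0 g00 g10 g01 h w₁ w₂ hJ rfl rfl rfl rfl
    rfl hl
  have hlpos : 0 < l := by
    obtain ⟨k1, k2, -, -⟩ := key 1 0
    have k0 : form2 K 1 0 = 1 := by simp [form2, hK.a20]
    rw [← hKdef, k0, mul_one] at k2
    obtain ⟨hp1, hp2⟩ := form2_pos (J := J) hF1 hF2 (M 0 0 * 1 + M 0 1 * 0) (M 1 0 * 1 + M 1 1 * 0)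
    rw [← k2] at hp1 hp2
    -- If l = 0, definiteness kills the tangential entries of the first column of `M`, and the first
    -- order relation kills its last entry.
    refine lt_of_le_of_ne hp1 fun hl0 => hM ?_
    obtain ⟨m0, m1⟩ := hp2 hl0.symm
    rw [m0, m1] at k1
    have c0 : M 0 0 = 0 := by linarith
    have c1 : M 1 0 = 0 := by linarith
    have c2 : M 2 0 = 0 := by linarith
    simp [Matrix.det_fin_three, c0, c1, c2]
  -- Scaling the tangential part by 1/σ and the transversal part by 1/σ² removes the scale from
  -- order two and leaves 1/σ and 1/σ² in orders three and four.
  obtain ⟨σ, hσ, hσl⟩ : ∃ σ, 0 < σ ∧ l = σ ^ 2 :=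
    ⟨√l, Real.sqrt_pos.2 hlpos, (Real.sq_sqrt hlpos.le).symm⟩
  rw [← hKdef, hσl] at key
  refine ⟨![M 0 0 / σ, M 0 1 / σ, M 1 0 / σ, M 1 1 / σ, M 0 2 / σ ^ 2, M 1 2 / σ ^ 2, 1 / σ],
    by simpa using hσ.le, ?_⟩
  have hX : ∀ a b x y : ℝ, a / σ * x + b / σ * y = (a * x + b * y) / σ := fun a b x y => by ring
  constructor <;> intro x y <;> obtain ⟨-, k2, k3, k4⟩ := key x y <;>
    simp only [Matrix.cons_val, hX]
  · have : form2 J ((M 0 0 * x + M 0 1 * y) / σ) ((M 1 0 * x + M 1 1 * y) / σ)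
        = form2 J (M 0 0 * x + M 0 1 * y) (M 1 0 * x + M 1 1 * y) / σ ^ 2 := by
      simp only [form2]; ring
    rw [this, ← k2]
    field_simp; ring
  · generalize M 0 0 * x + M 0 1 * y = X, M 1 0 * x + M 1 1 * y = Y at *
    have e1 : form3 J (X / σ) (Y / σ) = form3 J X Y / σ ^ 3 := by simp only [form3]; ring
    have e2 : polar2 J (X / σ) (Y / σ) (M 0 2 / σ ^ 2) (M 1 2 / σ ^ 2)
        = polar2 J X Y (M 0 2) (M 1 2) / σ ^ 3 := by simp only [polar2]; ring
    rw [e1, e2]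
    field_simp
    linear_combination -k3
  · generalize M 0 0 * x + M 0 1 * y = X, M 1 0 * x + M 1 1 * y = Y at *
    have e1 : form4 J (X / σ) (Y / σ) = form4 J X Y / σ ^ 4 := by simp only [form4]; ring
    have e2 : polar2 J (X / σ) (Y / σ) (M 0 2 / σ ^ 2) (M 1 2 / σ ^ 2)
        = polar2 J X Y (M 0 2) (M 1 2) / σ ^ 3 := by simp only [polar2]; ring
    have e3 : polar3 J (X / σ) (Y / σ) (M 0 2 / σ ^ 2) (M 1 2 / σ ^ 2)
        = polar3 J X Y (M 0 2) (M 1 2) / σ ^ 4 := by simp only [polar3]; ring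
    have e4 : form2 J (M 0 2 / σ ^ 2) (M 1 2 / σ ^ 2) = form2 J (M 0 2) (M 1 2) / σ ^ 4 := by
      simp only [form2]; ring
    rw [e1, e2, e3, e4]
    field_simp
    linear_combination -k4

/-- The target jet enters only through its forms of orders two to four, so jets at two points of the
surface may be exchanged although their higher orders may differ. -/
lemma IsNormalization.congr_right {J K K' : ℕ → ℕ → ℝ} {θ : Fin 7 → ℝ} (h : IsNormalization J K θ)
    (h2 : form2 K = form2 K') (h3 : form3 K = form3 K') (h4 : form4 K = form4 K') :
    IsNormalization J K' θ :=
  ⟨h2 ▸ h.two, by rw [← h2, ← h3]; exact h.three, by rw [← h2, ← h3, ← h4]; exact h.four⟩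

/-! ### From constant curvatures to infinitesimal normalizations -/

/-- On a surface with constant curvatures, the derivatives of a representing function at all points
near the origin can be normalized to those at the origin. -/
lemma eventually_exists_isNormalization {S : Set (Fin 3 → ℝ)} {I40 I31 I22 I13 I04 : ℝ}
    (hI : HasConstantCurvatures S I40 I31 I22 I13 I04) {p : Fin 3 → ℝ}
    {B : Matrix (Fin 3) (Fin 3) ℝ} {f : ℝ × ℝ → ℝ} (hB : IsGraphAt S p B f)
    (hf : HasStandardJet f) (h40 : jetCoeff f 4 0 = I40) (h31 : jetCoeff f 3 1 = I31)
    (h22 : jetCoeff f 2 2 = I22) (h13 : jetCoeff f 1 3 = I13) (h04 : jetCoeff f 0 4 = I04)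
    {U : Set (ℝ × ℝ)} (hU : IsOpen U) (h0U : (0, 0) ∈ U) (hF : IsJetFamily (partials f) U) :
    ∀ᶠ q in 𝓝 ((0, 0) : ℝ × ℝ), ∃ θ : Fin 7 → ℝ, 0 ≤ θ 6 ∧
      IsNormalization (fun i j => partials f i j q) (fun i j => partials f i j (0, 0)) θ := by
  have hK := hf.isStandard
  have cF : ∀ i j, ContinuousAt (partials f i j) (0, 0) := fun i j =>
    (hF.differentiableAt i j _ h0U).continuousAt
  have ev1 : ∀ᶠ q in 𝓝 ((0, 0) : ℝ × ℝ), 0 < partials f 2 0 q :=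
    (cF 2 0).eventually_const_lt (by rw [hK.a20]; norm_num)
  have ev2 : ∀ᶠ q in 𝓝 ((0, 0) : ℝ × ℝ),
      0 < partials f 2 0 q * partials f 0 2 q - partials f 1 1 q ^ 2 :=
    (((cF 2 0).mul (cF 0 2)).sub ((cF 1 1).pow 2)).eventually_const_lt (by
      simp [hK.a20, hK.a02, hK.a11])
  have hcurve : Tendsto (fun q : ℝ × ℝ => ![q.1, q.2, f q]) (𝓝 (0, 0)) (𝓝 0) := by
    refine tendsto_pi_nhds.2 fun i => ?_
    fin_cases i
    · exact continuous_fst.tendsto _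
    · exact continuous_snd.tendsto _
    · have := (cF 0 0).tendsto
      rwa [show partials f 0 0 (0, 0) = 0 from hf.a00] at this
  -- The graph description is needed on a neighbourhood of each nearby surface point, to be compared
  -- with the chart centred there; hence `eventually_nhds`.
  filter_upwards [ev1, ev2, hU.mem_nhds h0U, hcurve.eventually hB.graph.eventually_nhds]
    with q hq1 hq2 hqU hgr
  have hmem : B *ᵥ ![q.1, q.2, f q] + p ∈ S := hgr.self_of_nhds.2 rfl
  obtain ⟨C, g, hC, hg, k40, k31, k22, k13, k04⟩ := hI _ hmem
  obtain ⟨V, hV, h0V, hG⟩ := exists_isJetFamily_partials hC.smooth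
  have hBM : B * (B⁻¹ * C) = C := by
    rw [← mul_assoc, Matrix.mul_nonsing_inv _ (isUnit_iff_ne_zero.2 hB.det_ne_zero), one_mul]
  have hdet : (B⁻¹ * C).det ≠ 0 := fun h => hC.det_ne_zero (by rw [← hBM, Matrix.det_mul, h, mul_zero])
  generalize B⁻¹ * C = M at hBM hdet
  have hid : ∀ᶠ v in 𝓝 (0 : Fin 3 → ℝ), v 2 = partials g 0 0 (v 0, v 1) →
      (M *ᵥ v) 2 + partials f 0 0 q = partials f 0 0 ((M *ᵥ v) 0 + q.1, (M *ᵥ v) 1 + q.2) := by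
    have ht : Tendsto (fun v : Fin 3 → ℝ => M *ᵥ v + ![q.1, q.2, f q]) (𝓝 0)
        (𝓝 ![q.1, q.2, f q]) := by
      have : Continuous fun v : Fin 3 → ℝ => M *ᵥ v + ![q.1, q.2, f q] :=
        (Continuous.matrix_mulVec continuous_const continuous_id).add continuous_const
      simpa using this.tendsto 0
    filter_upwards [ht.eventually hgr, hC.graph] with v h1 h2 hv
    have h3 := h2.2 hv
    rw [← hBM, ← Matrix.mulVec_mulVec, ← add_assoc, ← Matrix.mulVec_add] at h3
    exact h1.1 h3
  obtain ⟨θ, hθ, hn⟩ := exists_isNormalization hU hV hF hG hqU h0V hg.a00 hg.a10 hg.a01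
    hg.isStandard hq1 hq2 hdet hid
  have hL := hg.isStandard
  refine ⟨θ, hθ, hn.congr_right ?_ ?_ ?_⟩ <;> funext x y
  · simp only [form2, hL.a20, hL.a11, hL.a02, hK.a20, hK.a11, hK.a02]
  · simp only [form3, hL.a30, hL.a21, hL.a12, hL.a03, hK.a30, hK.a21, hK.a12, hK.a03]
  · have hk : ∀ (u : ℝ × ℝ → ℝ) i j, partials u i j (0, 0) = jetCoeff u i j := fun _ _ _ => rfl
    simp only [form4, hk, h40, h31, h22, h13, h04, k40, k31, k22, k13, k04]

/-- A direction in which the derivatives of all orders of `f` at the origin are differentiated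
yields an infinitesimal normalization, if the derivatives at all points near the origin can be
normalized to those at the origin. -/
lemma exists_infinitesimal_along {F : ℕ → ℕ → ℝ × ℝ → ℝ} {U : Set (ℝ × ℝ)} (h0U : (0, 0) ∈ U)
    (hF : IsJetFamily F U) (hK : IsStandard fun i j => F i j (0, 0))
    (h : ∀ᶠ q in 𝓝 ((0, 0) : ℝ × ℝ), ∃ θ : Fin 7 → ℝ, 0 ≤ θ 6 ∧
      IsNormalization (fun i j => F i j q) (fun i j => F i j (0, 0)) θ) (u v : ℝ) :
    ∃ η, IsInfinitesimalNormalization (fun i j => F i j (0, 0))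
      (fun i j => F (i + 1) j (0, 0) * u + F i (j + 1) (0, 0) * v) 1 η := by
  set J : ℝ → ℕ → ℕ → ℝ := fun t i j => F i j (t * u, t * v) with hJ
  have hJ0 : J 0 = fun i j => F i j (0, 0) := by simp [hJ]
  have hd : ∀ i j, HasDerivAt (fun t => J t i j)
      (F (i + 1) j (0, 0) * u + F i (j + 1) (0, 0) * v) 0 := fun i j => by
    have := hF.hasDerivAt_comp i j (x := fun t => t * u) (y := fun t => t * v) (s := 0)
      (by simpa using (hasDerivAt_id (0 : ℝ)).mul_const u)
      (by simpa using (hasDerivAt_id (0 : ℝ)).mul_const v) (by simpa using h0U)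
    simpa using this
  have hline : Tendsto (fun t : ℝ => (t * u, t * v)) (𝓝 0) (𝓝 (0, 0)) := by
    have : Continuous fun t : ℝ => (t * u, t * v) := by fun_prop
    simpa using this.tendsto 0
  have ht := tendsto_one_div_add_atTop_nhds_zero_nat (𝕜 := ℝ)
  obtain ⟨N, hN⟩ := eventually_atTop.1 (ht.eventually (hline.eventually h))
  -- The shift by `N` puts every sample point where a normalization exists.
  set t : ℕ → ℝ := fun n => 1 / (((n + N : ℕ) : ℝ) + 1) with htdef
  have ht' : Tendsto t atTop (𝓝 0) := ht.comp (tendsto_add_atTop_nat N)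
  have htne : ∀ n, t n ≠ 0 := fun n => by simp only [htdef]; positivity
  rw [← hJ0] at hK hN ⊢
  have hJt : Tendsto (fun n => J (t n)) atTop (𝓝 (J 0)) :=
    tendsto_pi_nhds.2 fun i => tendsto_pi_nhds.2 fun j =>
      (hd i j).continuousAt.tendsto.comp ht'
  obtain ⟨φ, hφ, θ, hn, hlim⟩ := exists_normalizations_tendsto hK hJt
    (fun n => hN (n + N) (Nat.le_add_left _ _))
  exact exists_isInfinitesimalNormalization hd hK (ht'.comp hφ.tendsto_atTop) (fun n => htne _)
    hlim hn

/-! ### Solving the quadrics -/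

/-- The hypothesis is Im (a + ib)³ = 0: a + ib lies on one of three lines through the origin. -/
lemma eq_or_eq_of_sq_mul_eq {a b : ℝ} (h : 3 * a ^ 2 * b = b ^ 3) :
    b = 0 ∨ ∃ ε : ℝ, (ε = 1 ∨ ε = -1) ∧ b = ε * √3 * a := by
  have h3 : √3 ^ 2 = (3 : ℝ) := Real.sq_sqrt (by norm_num)
  have : b * ((b - √3 * a) * (b + √3 * a)) = 0 := by linear_combination -h - b * a ^ 2 * h3
  rcases mul_eq_zero.1 this with h | h
  · exact .inl h
  rcases mul_eq_zero.1 h with h | h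
  · exact .inr ⟨1, .inl rfl, by linarith⟩
  · exact .inr ⟨-1, .inr rfl, by linarith⟩

/-- The two points with d = 0 are split off because the fourth family has 0 < k < 3; they belong to
the first two families. -/
lemma circle_cases {c d : ℝ} (h : c ^ 2 + d ^ 2 = 9 / 4) :
    (c = 3 / 2 ∧ d = 0) ∨ (c = -3 / 2 ∧ d = 0) ∨ ∃ ε : ℝ, (ε = 1 ∨ ε = -1) ∧ 0 < c + 3 / 2 ∧
      c + 3 / 2 < 3 ∧ d = ε * √((c + 3 / 2) * (3 - (c + 3 / 2))) := by
  by_cases hd : d = 0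
  · subst hd
    have : (c - 3 / 2) * (c + 3 / 2) = 0 := by linear_combination h
    rcases mul_eq_zero.1 this with h | h
    · exact .inl ⟨by linarith, rfl⟩
    · exact .inr (.inl ⟨by linarith, rfl⟩)
  · have hd2 : 0 < d ^ 2 := by positivity
    rw [show (c + 3 / 2) * (3 - (c + 3 / 2)) = d ^ 2 by linear_combination -h,
      Real.sqrt_sq_eq_abs]
    have hc : 0 < c + 3 / 2 ∧ c + 3 / 2 < 3 := ⟨by nlinarith, by nlinarith⟩
    rcases lt_or_gt_of_ne hd with h | h
    · exact .inr (.inr ⟨-1, .inr rfl, hc.1, hc.2, by rw [abs_of_neg h]; ring⟩)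
    · exact .inr (.inr ⟨1, .inl rfl, hc.1, hc.2, by rw [abs_of_pos h]; ring⟩)

/-- The real solutions of the first order compatibility conditions on the fundamental curvatures
`(p, q, r, s, t) = (I40, I31, I22, I13, I04)`. -/

lemma curvatures_classification {p q r s t : ℝ}
    (h1 : 3 * p * q + 17 * p * s - 15 * q * r - 4 * q * t + 3 * r * s - 36 * s = 0)
    (h2 : 3 * p * r + p * t + 10 * q * s - 9 * r ^ 2 - 3 * r * t + 18 * r + 2 * s ^ 2 + 6 * t = 0)
    (h3 : 6 * p * s - 3 * q * r - q * t + 3 * r * s - s * t - 12 * s = 0)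
    (h4 : 6 * p * t - 18 * p + 6 * q * s - 9 * r ^ 2 - 12 * r * t + 18 * r + 14 * s ^ 2 - t ^ 2
      = 0) :
    (∃ k : ℝ, (p, q, r, s, t) = (k, 0, -1, 0, 3)) ∨
    (∃ k : ℝ, (p, q, r, s, t) =
      (-3 * k ^ 2 + 6 * k, 0, -k ^ 2 + 2 * k + 2, 0, -3 * k ^ 2 - 6 * k)) ∨
    (∃ k l : ℝ, (p, q, r, s, t) = (k, l, k, 0, -3 * k)) ∨
    (∃ k ε : ℝ, 0 < k ∧ k < 3 ∧ (ε = 1 ∨ ε = -1) ∧ (p, q, r, s, t) =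
      (k, ε * √(k * (3 - k)), -k + 2, -ε * √(k * (3 - k)), k)) ∨
    (∃ k ε : ℝ, (ε = 1 ∨ ε = -1) ∧ (p, q, r, s, t) =
      (-3 * k ^ 2 + ε * (3 / 4) * k + 9 / 4, -(3 * √3 / 4) * (3 * k - ε),
        -k ^ 2 + ε * (1 / 4) * k - 1 / 4, -(3 * √3 / 4) * (k + ε),
        -3 * k ^ 2 - ε * (21 / 4) * k + 9 / 4)) ∨
    (∃ k ε : ℝ, (ε = 1 ∨ ε = -1) ∧ (p, q, r, s, t) =
      (k, ε * (√3 / 2) * (2 * k - 3), 3 * k - 1, ε * (3 * √3 / 2) * (2 * k - 1), 9 * k - 6)) := by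
  -- With α = a + ib and γ = c + id, the quartic form is R|z|⁴ + |z|² Re(ᾱz²) + Re(γ̄z⁴). The
  -- quadrics become Im(αγ) = 0, 12R + |α|² - 2Re(αγ) - 8|γ|² = 0 and R(ᾱ + 4γ) - 3ᾱ - 6γ = α² +
  -- 2αγ̄; the last one is `e3` and `e4`.
  obtain ⟨R, a, b, c, d, rfl, rfl, rfl, rfl, rfl⟩ : ∃ R a b c d : ℝ, p = R + a + c ∧
      q = b / 2 + d ∧ r = R / 3 - c ∧ s = b / 2 - d ∧ t = R - a + c :=
    ⟨3 * (r + (p + t - 6 * r) / 8), (p - t) / 2, q + s, (p + t - 6 * r) / 8, (q - s) / 2,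
      by ring, by ring, by ring, by ring, by ring⟩
  simp only [Prod.mk.injEq]
  have e1 : a * d + b * c = 0 := by linear_combination (h1 - 3 * h3) / 8
  have e2 : 12 * R + a ^ 2 + b ^ 2 - 2 * (a * c - b * d) - 8 * (c ^ 2 + d ^ 2) = 0 := by
    linear_combination (3 * h2 - h4) / 4
  have e3 : R * (a + 4 * c) - 3 * a - 6 * c = a ^ 2 - b ^ 2 + 2 * (a * c + b * d) := by
    linear_combination (h2 + h4) / 8
  have e4 : R * (-b + 4 * d) + 3 * b - 6 * d = 2 * a * b + 2 * (b * c - a * d) := by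
    linear_combination -h3 / 2 - e1
  clear h1 h2 h3 h4
  by_cases hab : a = 0 ∧ b = 0
  · obtain ⟨rfl, rfl⟩ := hab
    by_cases hR : R = 3 / 2
    · subst hR
      have hcd : c ^ 2 + d ^ 2 = 9 / 4 := by linear_combination -e2 / 8
      rcases circle_cases hcd with ⟨rfl, rfl⟩ | ⟨rfl, rfl⟩ | ⟨ε, hε, h0, h3, hd⟩
      · exact .inl ⟨3, by norm_num⟩
      · exact .inr (.inl ⟨0, by norm_num⟩)
      · refine .inr (.inr (.inr (.inl ⟨c + 3 / 2, ε, h0, h3, hε, ?_, ?_, ?_, ?_, ?_⟩))) <;>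
          linarith
    · have hc : c = 0 := by
        have : (R - 3 / 2) * c = 0 := by linear_combination e3 / 4
        exact (mul_eq_zero.1 this).resolve_left (sub_ne_zero.2 hR)
      have hd : d = 0 := by
        have : (R - 3 / 2) * d = 0 := by linear_combination e4 / 4
        exact (mul_eq_zero.1 this).resolve_left (sub_ne_zero.2 hR)
      subst hc hd
      have hR : R = 0 := by linarith
      exact .inr (.inr (.inl ⟨0, 0, by refine ⟨?_, ?_, ?_, ?_, ?_⟩ <;> linarith⟩))
  · have hN : a ^ 2 + b ^ 2 ≠ 0 := fun h => hab ⟨by nlinarith, by nlinarith⟩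
    -- For α ≠ 0, reality of αγ means γ = mᾱ with m real. Multiplied by α, the complex equation
    -- reads (R(1 + 4m) - 3 - 6m)|α|² = (1 + 2m)α³, so m = -1/2 or α³ is real.
    obtain ⟨m, rfl, rfl⟩ : ∃ m, c = m * a ∧ d = -(m * b) := by
      refine ⟨(a * c - b * d) / (a ^ 2 + b ^ 2), ?_, ?_⟩
      · field_simp; linear_combination b * e1
      · field_simp; linear_combination a * e1
    by_cases hm : m = -1 / 2
    · subst hm
      have hR : R = 0 := by linarith
      subst hR
      exact .inr (.inr (.inl ⟨a / 2, b, by refine ⟨?_, ?_, ?_, ?_, ?_⟩ <;> ring⟩))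
    · have hm' : 1 + 2 * m ≠ 0 := fun h => hm (by linarith)
      have him : 3 * a ^ 2 * b = b ^ 3 := by
        have : (1 + 2 * m) * (3 * a ^ 2 * b - b ^ 3) = 0 := by
          linear_combination -b * e3 - a * e4
        linarith [(mul_eq_zero.1 this).resolve_left hm']
      -- Here α is ρ times a cube root of unity. Eliminating R uses 1 - 2m - 8m² = (1 + 2m)(1 - 4m)
      -- and leaves a difference of squares.
      have key : ∀ ρ : ℝ, ρ ^ 2 = a ^ 2 + b ^ 2 →
          R * (1 + 4 * m) - 3 - 6 * m = ρ * (1 + 2 * m) →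
          4 * m * ρ = ρ + 6 ∨ 4 * m * ρ = -(ρ + 6) := by
        intro ρ h5 h6
        have : (1 + 2 * m) * ((ρ + 6) ^ 2 - (4 * m * ρ) ^ 2) = 0 := by
          linear_combination -12 * h6 + (1 + 4 * m) * e2
            + (1 + 4 * m) * (1 - 2 * m - 8 * m ^ 2) * h5
        have := (mul_eq_zero.1 this).resolve_left hm'
        exact (sq_eq_sq_iff_eq_or_eq_neg.1 (sub_eq_zero.1 this)).imp Eq.symm fun h => by linarith
      rcases eq_or_eq_of_sq_mul_eq him with rfl | ⟨ε, hε, rfl⟩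
      · have ha : a ≠ 0 := fun h => hab ⟨h, rfl⟩
        have h6 : R * (1 + 4 * m) - 3 - 6 * m = a * (1 + 2 * m) :=
          mul_left_cancel₀ ha (by linear_combination e3)
        rcases key a (by ring) h6 with h | h
        · have hc : m * a = (a + 6) / 4 := by linarith
          rw [hc] at e2 ⊢
          have hR : R = (3 * a + 6) / 4 := by linear_combination e2 / 12
          subst hR
          exact .inl ⟨2 * a + 3, by refine ⟨?_, ?_, ?_, ?_, ?_⟩ <;> ring⟩
        · have hc : m * a = -(a + 6) / 4 := by linarith
          rw [hc] at e2 ⊢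
          have hR : R = (-a ^ 2 + 3 * a + 18) / 12 := by linear_combination e2 / 12
          subst hR
          exact .inr (.inl ⟨a / 6, by refine ⟨?_, ?_, ?_, ?_, ?_⟩ <;> ring⟩)
      -- The previous case turned by a third of a full turn, with ρ = -2a in place of ρ = a:
      -- families 6 and 5 correspond to families 1 and 2.
      · have h3 : √3 ^ 2 = (3 : ℝ) := Real.sq_sqrt (by norm_num)
        have hε2 : ε ^ 2 = 1 := by rcases hε with rfl | rfl <;> norm_num
        have ha : a ≠ 0 := fun h => hab ⟨h, by simp [h]⟩
        have h6 : R * (1 + 4 * m) - 3 - 6 * m = -2 * a * (1 + 2 * m) :=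
          mul_left_cancel₀ ha (by
            linear_combination e3 + (- (a ^ 2) - 2 * m * a ^ 2) * (h3 * ε ^ 2 + 3 * hε2))
        have hR' : R = -a ^ 2 / 3 + 2 * m * a ^ 2 / 3 + 8 * m ^ 2 * a ^ 2 / 3 := by
          linear_combination e2 / 12 + (-a ^ 2 + 2 * m * a ^ 2 + 8 * m ^ 2 * a ^ 2) / 12 *
            (h3 * ε ^ 2 + 3 * hε2)
        rcases key (-2 * a) (by linear_combination (-a ^ 2) * (h3 * ε ^ 2 + 3 * hε2)) h6 with h | h
        · have hc : m * a = (a - 3) / 4 := by linarith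
          have hR : R = (3 - 3 * a) / 2 := by
            linear_combination hR' + (2 * a / 3 + 2 * (m * a + (a - 3) / 4) * 4 / 3) * hc
          have hd : -(m * (ε * √3 * a)) = -(ε * √3 * ((a - 3) / 4)) := by rw [← hc]; ring
          rw [hc, hd, hR]
          refine .inr (.inr (.inr (.inr (.inr ⟨(3 - a) / 4, -ε, ?_, ?_, ?_, ?_, ?_, ?_⟩))))
          · rcases hε with rfl | rfl <;> simp
          all_goals ring
        · have hc : m * a = (3 - a) / 4 := by linarith
          have hR : R = (-2 * a ^ 2 - 3 * a + 9) / 6 := by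
            linear_combination hR' + (2 * a / 3 + 2 * (m * a + (3 - a) / 4) * 4 / 3) * hc
          have hd : -(m * (ε * √3 * a)) = -(ε * √3 * ((3 - a) / 4)) := by rw [← hc]; ring
          rw [hc, hd, hR]
          refine .inr (.inr (.inr (.inr (.inl ⟨-ε * a / 3, -ε, ?_, ?_, ?_, ?_, ?_, ?_⟩))))
          · rcases hε with rfl | rfl <;> simp
          · linear_combination (a ^ 2 / 3 - a / 4) * hε2
          · ring
          · linear_combination (a ^ 2 / 9 - a / 12) * hε2
          · ring
          · linear_combination (a ^ 2 / 3 + 7 * a / 4) * hε2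

/-! ### Conclusion -/

/-- Constant fundamental curvatures satisfy four quadratic equations. -/
theorem fundamental_curvatures_quadrics {S : Set (Fin 3 → ℝ)} (hne : S.Nonempty)
    {p q r s t : ℝ} (hI : HasConstantCurvatures S p q r s t) :
    3 * p * q + 17 * p * s - 15 * q * r - 4 * q * t + 3 * r * s - 36 * s = 0 ∧
    3 * p * r + p * t + 10 * q * s - 9 * r ^ 2 - 3 * r * t + 18 * r + 2 * s ^ 2 + 6 * t = 0 ∧
    6 * p * s - 3 * q * r - q * t + 3 * r * s - s * t - 12 * s = 0 ∧
    6 * p * t - 18 * p + 6 * q * s - 9 * r ^ 2 - 12 * r * t + 18 * r + 14 * s ^ 2 - t ^ 2 = 0 := by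
  obtain ⟨P, hP⟩ := hne
  obtain ⟨B, f, hB, hf, h40, h31, h22, h13, h04⟩ := hI P hP
  obtain ⟨U, hU, h0U, hF⟩ := exists_isJetFamily_partials hB.smooth
  have hev := eventually_exists_isNormalization hI hB hf h40 h31 h22 h13 h04 hU h0U hF
  obtain ⟨θ, hθ⟩ := exists_infinitesimal_along h0U hF hf.isStandard hev 1 0
  obtain ⟨η, hη⟩ := exists_infinitesimal_along h0U hF hf.isStandard hev 0 1
  simp only [mul_one, mul_zero, add_zero, zero_add] at hθ hη
  exact IsInfinitesimalNormalization.compatibility hf.isStandard hθ hη h40 h31 h22 h13 h04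

end AffineSurface

theorem theorem5p1 (S : Set (Fin 3 → ℝ)) (hne : S.Nonempty)
    (hS : AffineSurface.IsRegularElliptical S) (I40 I31 I22 I13 I04 : ℝ)
    (hI : AffineSurface.HasConstantCurvatures S I40 I31 I22 I13 I04) :
    (∃ k : ℝ, (I40, I31, I22, I13, I04) = (k, 0, -1, 0, 3)) ∨
    (∃ k : ℝ, (I40, I31, I22, I13, I04) =
      (-3 * k ^ 2 + 6 * k, 0, -k ^ 2 + 2 * k + 2, 0, -3 * k ^ 2 - 6 * k)) ∨
    (∃ k l : ℝ, (I40, I31, I22, I13, I04) = (k, l, k, 0, -3 * k)) ∨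
    (∃ k ε : ℝ, 0 < k ∧ k < 3 ∧ (ε = 1 ∨ ε = -1) ∧ (I40, I31, I22, I13, I04) =
      (k, ε * √(k * (3 - k)), -k + 2, -ε * √(k * (3 - k)), k)) ∨
    (∃ k ε : ℝ, (ε = 1 ∨ ε = -1) ∧ (I40, I31, I22, I13, I04) =
      (-3 * k ^ 2 + ε * (3 / 4) * k + 9 / 4, -(3 * √3 / 4) * (3 * k - ε),
        -k ^ 2 + ε * (1 / 4) * k - 1 / 4, -(3 * √3 / 4) * (k + ε),
        -3 * k ^ 2 - ε * (21 / 4) * k + 9 / 4)) ∨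
    (∃ k ε : ℝ, (ε = 1 ∨ ε = -1) ∧ (I40, I31, I22, I13, I04) =
      (k, ε * (√3 / 2) * (2 * k - 3), 3 * k - 1, ε * (3 * √3 / 2) * (2 * k - 1), 9 * k - 6)) := by
  obtain ⟨h1, h2, h3, h4⟩ := AffineSurface.fundamental_curvatures_quadrics hne hI
  exact AffineSurface.curvatures_classification h1 h2 h3 h4
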